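/- **Setting.** Let $\hbar,m,\epsilon_0,\omega,L,L_z>0$, $e\neq 0$ and $N\ge 1$. Consider $N$ spin-$\tfrac12$ electrons on the periodic square $[0,L]^2$, coupled in the dipole approximation to one cavity mode with two polarizations $\mathbf e_x,\mathbf e_y$, in the volume $V=L^2L_z$. On the antisymmetric states, let $$\hat H=\sum_{j=1}^N\Big[-\frac{\hbar^2}{2m}\nabla_j^2+\frac{ie\hbar}{m}\hat{\mathbf A}\cdot\nabla_j\Big]+\frac{Ne^2}{2m}\hat{\mathbf A}^2+\sum_{d=1}^2\hbar\omega\big(\hat a_d^\dagger\hat a_d+\tfrac12\big),\qquad \hat A_d=\sqrt{\frac{\hbar}{2\epsilon_0V\omega}}\,(\hat a_d+\hat a_d^\dagger),$$ with domain the states on which the kinetic energy and the bare photon energy are square-summable. Put $n_e=N/V$, $\omega_p=\sqrt{e^2n_e/(m\epsilon_0)}$, $\tilde\omega=\sqrt{\omega^2+\omega_p^2}$ and $\gamma=\omega_p^2/\tilde\omega^2$. Let $\Psi$ be either a ground state (a normalized minimizer of the energy), or the thermodynamic-limit ground state: the Slater determinant of a doubly occupied Fermi disk $|\mathbf k|\le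 k_F$ that contains exactly $N$ spin orbitals, times the vacuum of the two dressed photon modes $\hat b_d=\frac{1}{2\sqrt{\omega\tilde\omega}}[(\tilde\omega+\omega)\hat a_d+(\tilde\omega-\omega)\hat a_d^\dagger]$. Fix a direction $d$ and let $\hat J=-\frac{ie\hbar}{m}\sum_j\partial_{j,d}-\frac{e^2N}{m}\hat A_d$. For operators $O,P$ let $$\chi^O_P(t,t')=-\frac{i}{\hbar}\Theta(t-t')\langle\Psi|[O_I(t),P_I(t')]|\Psi\rangle,\qquad O_I(t)=e^{i\hat Ht/\hbar}Oe^{-i\hat Ht/\hbar},\qquad \chi^O_P(z)=\int_{-\infty}^{\infty}e^{iz\tau}\chi^O_P(\tau,0)\,d\tau$$ for $z=w+i\eta$ with $w\in\mathbb R$, $\eta>0$. The conductivity is given by the Kubo formula $$\sigma(z)=\frac{1}{iz}\Big(-\frac{e^2n_e}{m}-\frac{\chi^J_J(z)}{V}\Big).$$ **Claim.** A ground state exists and $0<\gamma<1$. Moreover, for every such $\Psi$ and $d$: 1. If $\Psi$ is the Fermi-disk state, then $\big(-\frac{ie\hbar}{m}\sum_j\partial_{j,d}\big)\Psi=0$ and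 $\langle\Psi|\hat J|\Psi\rangle=0$. 2. For all $t,t'$: $\chi^A_A(t,t')=-\dfrac{\Theta(t-t')\sin(\tilde\omega(t-t'))}{\epsilon_0\tilde\omega V}$ and $\chi^J_J(t,t')=\big(\frac{e^2N}{m}\big)^2\chi^A_A(t,t')$, where $\chi^A_A$ is the response function of $\hat A_d$ to $\hat A_d$. 3. For $z=w+i\eta$, $\eta>0$: $\chi^A_A(z)=-\dfrac{1}{2\epsilon_0\tilde\omega V}\Big[\dfrac1{z+\tilde\omega}-\dfrac1{z-\tilde\omega}\Big]$. 4. $\sigma$ is the ratio of induced current density and applied field: if $A\in C^1(\mathbb R,\mathbb R)$ vanishes on $(-\infty,0]$, and $e^{-\eta t}A$ and $e^{-\eta t}A'$ are integrable, then with $E=-A'$ and $j(t)=\frac1V\big(-\frac{e^2N}{m}A(t)-\int_0^\infty\chi^J_J(t,t')A(t')\,dt'\big)$ the function $e^{izt}j(t)$ is integrable and $\int e^{izt}j(t)\,dt=\sigma(z)\int e^{izt}E(t)\,dt$. 5. The optical conductivity is the Drude term plus a cavity term proportional to the $A$-field propagator: for $z=w+i\eta$, $\eta>0$, $$\sigma(z)=\frac{i\epsilon_0\omega_p^2}{z}+\frac{i}{zV}\Big(\frac{e^2N}{m}\Big)^2\chi^A_A(z)=\frac{i\epsilon_0\omega_p^2}{w+i\eta}-\frac{i\epsilon_0\omega_p^4}{(w+i\eta)\,2\tilde\omega}\Big[\frac1{w+\tilde\omega+i\eta}-\frac1{w-\tilde\omega+i\eta}\Big].$$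 For real $w\notin\{0,\tilde\omega,-\tilde\omega\}$, $\sigma(w+i\eta)$ converges as $\eta\to0^+$ to the right-hand side with $\eta=0$. 6. From the upper half plane, $\chi^A_A(z)$ and $\sigma(z)$ continue meromorphically to $\mathbb C$. The singularities of $\chi^A_A$ are exactly simple poles at $\pm\tilde\omega$; those of $\sigma$ are exactly simple poles at $0$ and $\pm\tilde\omega$. 7. For $\eta>0$ the DC conductivity without the cavity term is $\sigma^0_{\rm dc}=\lim_{w\to0}\Re\frac{i\epsilon_0\omega_p^2}{w+i\eta}=\epsilon_0\omega_p^2/\eta$, and the one in the cavity is $$\sigma_{\rm dc}(\gamma)=\lim_{w\to0}\Re\,\sigma(w+i\eta)=\sigma^0_{\rm dc}\Big(1-\frac{\gamma}{1+\eta^2/\tilde\omega^2}\Big).$$ As $\eta\to0^+$, $\sigma_{\rm dc}(\gamma)=\sigma_{\rm dc}^0(1-\gamma)$ in the sense that $\sigma_{\rm dc}(\gamma)/\sigma^0_{\rm dc}\to1-\gamma$ and $\sigma_{\rm dc}(\gamma)-\sigma^0_{\rm dc}(1-\gamma)\to0$. -/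

import Mathlib

open Filter Topology MeasureTheory

noncomputable section

namespace CavityQED

/-- Physical parameters of the two-dimensional electron gas in a single-mode cavity. -/
structure Params where
  /-- reduced Planck constant -/
  hbar : ℝ
  /-- electron mass -/
  mass : ℝ
  /-- electron charge -/
  charge : ℝ
  /-- vacuum permittivity -/
  eps0 : ℝ
  /-- bare frequency of the cavity mode -/
  omega : ℝ
  /-- side of the square material and of the mirrors -/
  side : ℝ
  /-- distance between the mirrors -/
  height : ℝ
  hbar_pos : 0 < hbar
  mass_pos : 0 < mass
  charge_ne : charge ≠ 0
  eps0_pos : 0 < eps0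
  omega_pos : 0 < omega
  side_pos : 0 < side
  height_pos : 0 < height

/-- The cavity volume `V = L² L_z`. -/
def volume (p : Params) : ℝ := p.side ^ 2 * p.height

/-- The electron density `n_e = N / V`. -/
def density (p : Params) (N : ℕ) : ℝ := N / volume p

/-- `ω_p = √(e² n_e / (m ε₀))`. -/
def plasmaFreq (p : Params) (N : ℕ) : ℝ :=
  Real.sqrt (p.charge ^ 2 * density p N / (p.mass * p.eps0))

/-- The plasmon-polariton frequency `ω̃ = √(ω² + ω_p²)`. -/
def dressedFreq (p : Params) (N : ℕ) : ℝ :=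
  Real.sqrt (p.omega ^ 2 + plasmaFreq p N ^ 2)

/-- The collective coupling `γ = ω_p² / ω̃²`. -/
def coupling (p : Params) (N : ℕ) : ℝ := plasmaFreq p N ^ 2 / dressedFreq p N ^ 2

/-- Labels of one-electron plane waves with spin, `e^{i k·r} / √S` with `k = 2π n / L`,
`n ∈ ℤ²`, together with a spin label. -/
abbrev Orbital : Type := (Fin 2 → ℤ) × Bool

/-- Labels of the product basis: an orbital for each of the `N` electrons, and the photon number
in each of the two polarizations. -/
abbrev Idx (N : ℕ) : Type := (Fin N → Orbital) × (Fin 2 → ℕ)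

/-- Amplitudes of arbitrary (not necessarily normalizable) wave functions. -/
abbrev Amp (N : ℕ) : Type := Idx N → ℂ

/-- The Hilbert space of `N` distinguishable electrons and two photon polarizations, in the basis
of plane waves and photon numbers. The physical states are its antisymmetric elements. -/
abbrev State (N : ℕ) : Type := lp (fun _ : Idx N => ℂ) 2

/-- Antisymmetry under the exchange of electrons (positions and spins). -/
def IsFermionic {N : ℕ} (ψ : Amp N) : Prop :=
  ∀ (π : Equiv.Perm (Fin N)) (x : Fin N → Orbital) (n : Fin 2 → ℕ),
    ψ (x ∘ π, n) = ((Equiv.Perm.sign π : ℤ) : ℂ) * ψ (x, n)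

/-- Component `d` of the wave vector `k = 2π n / L`. -/
def waveVector (p : Params) (o : Orbital) (d : Fin 2) : ℝ :=
  2 * Real.pi * (o.1 d : ℝ) / p.side

/-- The derivative `∂/∂r_{j,d}`: it multiplies `e^{i k_j · r_j}` by `i k_{j,d}`. -/
def nabla (p : Params) (N : ℕ) (j : Fin N) (d : Fin 2) : Module.End ℂ (Amp N) where
  toFun ψ := fun x => Complex.I * (waveVector p (x.1 j) d : ℂ) * ψ x
  map_add' ψ φ := by ext x; simp [mul_add]
  map_smul' c ψ := by ext x; simp; ring

/-- The bare photon annihilation operator `a_d`, with `a |n⟩ = √n |n - 1⟩`. -/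
def annih (N : ℕ) (d : Fin 2) : Module.End ℂ (Amp N) where
  toFun ψ := fun x =>
    (Real.sqrt ((x.2 d : ℝ) + 1) : ℂ) * ψ (x.1, Function.update x.2 d (x.2 d + 1))
  map_add' ψ φ := by ext x; simp [mul_add]
  map_smul' c ψ := by ext x; simp; ring

/-- The bare photon creation operator `a†_d`, with `a† |n⟩ = √(n + 1) |n + 1⟩`. -/
def creat (N : ℕ) (d : Fin 2) : Module.End ℂ (Amp N) where
  toFun ψ := fun x =>
    (Real.sqrt (x.2 d : ℝ) : ℂ) * ψ (x.1, Function.update x.2 d (x.2 d - 1))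
  map_add' ψ φ := by ext x; simp [mul_add]
  map_smul' c ψ := by ext x; simp; ring

/-- Component `d` of the quantized vector potential, `√(ħ / (2 ε₀ V ω)) (a_d + a†_d)`. -/
def vecPot (p : Params) (N : ℕ) (d : Fin 2) : Module.End ℂ (Amp N) :=
  (Real.sqrt (p.hbar / (2 * p.eps0 * volume p * p.omega)) : ℂ) • (annih N d + creat N d)

/-- The electronic kinetic energy `-(ħ² / 2m) ∑_j ∇_j²`. -/
def kinetic (p : Params) (N : ℕ) : Module.End ℂ (Amp N) :=
  ((-(p.hbar ^ 2 / (2 * p.mass)) : ℝ) : ℂ) •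
    ∑ j : Fin N, ∑ d : Fin 2, nabla p N j d * nabla p N j d

/-- The bare photon energy `∑_d ħ ω (a†_d a_d + 1/2)`. -/
def photonEnergy (p : Params) (N : ℕ) : Module.End ℂ (Amp N) :=
  ((p.hbar * p.omega : ℝ) : ℂ) • ∑ d : Fin 2, (creat N d * annih N d + (1 / 2 : ℂ) • 1)

/-- The Pauli-Fierz Hamiltonian in the dipole approximation,
`∑_j [-(ħ²/2m) ∇_j² + (i e ħ/m) A·∇_j] + (N e²/2m) A² + ∑_d ħ ω (a†_d a_d + 1/2)`. -/
def hamiltonian (p : Params) (N : ℕ) : Module.End ℂ (Amp N) :=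
  kinetic p N
  + (Complex.I * ((p.charge * p.hbar / p.mass : ℝ) : ℂ)) •
      (∑ j : Fin N, ∑ d : Fin 2, vecPot p N d * nabla p N j d)
  + ((N * p.charge ^ 2 / (2 * p.mass) : ℝ) : ℂ) • (∑ d : Fin 2, vecPot p N d * vecPot p N d)
  + photonEnergy p N

/-- The paramagnetic current `-(i e ħ/m) ∑_j ∂_{j,d}`. -/
def currentPara (p : Params) (N : ℕ) (d : Fin 2) : Module.End ℂ (Amp N) :=
  (-(Complex.I * ((p.charge * p.hbar / p.mass : ℝ) : ℂ))) • ∑ j : Fin N, nabla p N j d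

/-- The diamagnetic current `-(e² N/m) A_d`. -/
def currentDia (p : Params) (N : ℕ) (d : Fin 2) : Module.End ℂ (Amp N) :=
  ((-(p.charge ^ 2 * N / p.mass) : ℝ) : ℂ) • vecPot p N d

/-- The current operator without its external-field part. -/
def current (p : Params) (N : ℕ) (d : Fin 2) : Module.End ℂ (Amp N) :=
  currentPara p N d + currentDia p N d

open Classical in
/-- An operator on amplitudes, acting on those square-summable states that it maps to
square-summable states (and by `0` on the others). -/
def applyOp {N : ℕ} (O : Module.End ℂ (Amp N)) (ψ : State N) : State N :=
  if h : Memℓp (O (ψ : Amp N) : (i : Idx N) → (fun _ => ℂ) i) 2 then ⟨O (ψ : Amp N), h⟩ else 0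

/-- The domain of self-adjointness of the Hamiltonian on the antisymmetric states: finite kinetic
and photon energy in the operator sense. -/
def InDomain (p : Params) (N : ℕ) (ψ : State N) : Prop :=
  IsFermionic (ψ : Amp N) ∧
  Memℓp (kinetic p N (ψ : Amp N) : (i : Idx N) → (fun _ => ℂ) i) 2 ∧
  Memℓp (photonEnergy p N (ψ : Amp N) : (i : Idx N) → (fun _ => ℂ) i) 2

/-- Norm-differentiable solutions of the Schrödinger equation `i ħ ∂_t ψ = H ψ`. -/
def IsSchrodingerSolution (p : Params) (N : ℕ) (f : ℝ → State N) : Prop :=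
  ∀ t : ℝ, InDomain p N (f t) ∧
    HasDerivAt f ((-(Complex.I / (p.hbar : ℂ))) • applyOp (hamiltonian p N) (f t)) t

open Classical in
/-- The unitary evolution `e^{-i H t/ħ} ψ` for `ψ` in the domain of `H`: the value at time `t` of
the solution of the Schrödinger equation that starts from `ψ`. -/
def evolve (p : Params) (N : ℕ) (t : ℝ) (ψ : State N) : State N :=
  if h : ∃ f : ℝ → State N, IsSchrodingerSolution p N f ∧ f 0 = ψ then h.choose t else 0

/-- The interaction picture `O_I(t) ψ = e^{i H t/ħ} O e^{-i H t/ħ} ψ`. -/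
def interaction (p : Params) {N : ℕ} (O : Module.End ℂ (Amp N)) (t : ℝ) (ψ : State N) : State N :=
  evolve p N (-t) (applyOp O (evolve p N t ψ))

/-- The retarded (Kubo) response function
`χ^O_P(t, t') = -(i/ħ) Θ(t - t') ⟨Ψ| [O_I(t), P_I(t')] |Ψ⟩`. -/
def response (p : Params) {N : ℕ} (O P : Module.End ℂ (Amp N)) (Ψ : State N) (t t' : ℝ) : ℂ :=
  -(Complex.I / (p.hbar : ℂ)) * (if t' ≤ t then 1 else 0) *
    inner ℂ Ψ (interaction p O t (interaction p P t' Ψ) - interaction p P t' (interaction p O t Ψ))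

/-- The response function at complex frequency `z = w + i η`, `η > 0`. -/
def responseFreq (p : Params) {N : ℕ} (O P : Module.End ℂ (Amp N)) (Ψ : State N) (z : ℂ) : ℂ :=
  ∫ τ : ℝ, Complex.exp (Complex.I * z * (τ : ℂ)) * response p O P Ψ τ 0

/-- The Kubo conductivity `σ = (-e² n_e/m - χ^J_J(z)/V) / (i z)`, `z = w + i η`. -/
def conductivity (p : Params) {N : ℕ} (d : Fin 2) (Ψ : State N) (z : ℂ) : ℂ :=
  (-((p.charge ^ 2 * density p N / p.mass : ℝ) : ℂ)
    - responseFreq p (current p N d) (current p N d) Ψ z / (volume p : ℂ)) / (Complex.I * z)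

/-- The current density induced, to first order, by the external vector potential `A e_d` switched
on at time `0`: the external diamagnetic current plus the Kubo response of the current to the
perturbation `-J_d A(t)`. -/
def inducedCurrent (p : Params) {N : ℕ} (d : Fin 2) (Ψ : State N) (A : ℝ → ℝ) (t : ℝ) : ℂ :=
  (-((p.charge ^ 2 * N / p.mass : ℝ) : ℂ) * (A t : ℂ)
    - ∫ t' in Set.Ioi (0 : ℝ), response p (current p N d) (current p N d) Ψ t t' * (A t' : ℂ))
    / (volume p : ℂ)

/-- Normalized minimizers of the energy of `N` electrons in the cavity. -/
def IsGroundState (p : Params) (N : ℕ) (Ψ : State N) : Prop :=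
  InDomain p N Ψ ∧ ‖Ψ‖ = 1 ∧
  ∀ Φ : State N, InDomain p N Φ → ‖Φ‖ = 1 →
    (inner ℂ Ψ (applyOp (hamiltonian p N) Ψ)).re ≤ (inner ℂ Φ (applyOp (hamiltonian p N) Φ)).re

/-- The Slater determinant of the plane waves `κ 0, …, κ (N - 1)`, as an amplitude. -/
def slater {N : ℕ} (κ x : Fin N → Orbital) : ℂ :=
  (1 / (Real.sqrt (N.factorial : ℝ) : ℂ)) *
    Matrix.det (Matrix.of fun i j : Fin N => if κ i = x j then (1 : ℂ) else 0)

/-- The annihilation operator of the dressed photon mode,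
`b_d = [a_d (ω̃ + ω) + a†_d (ω̃ - ω)] / (2 √(ω ω̃))`. -/
def dressedAnnih (p : Params) (N : ℕ) (d : Fin 2) : Module.End ℂ (Amp N) :=
  (1 / (2 * Real.sqrt (p.omega * dressedFreq p N) : ℝ) : ℂ) •
    (((dressedFreq p N + p.omega : ℝ) : ℂ) • annih N d
      + ((dressedFreq p N - p.omega : ℝ) : ℂ) • creat N d)

/-- The thermodynamic-limit ground state: the Slater determinant of a doubly occupied Fermi disk
`|k| ≤ k_F`, times the vacuum of the two dressed photon modes. -/
def IsFermiSeaState (p : Params) (N : ℕ) (Ψ : State N) : Prop :=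
  ‖Ψ‖ = 1 ∧
  (∃ (kF : ℝ) (κ : Fin N → Orbital) (φ : (Fin 2 → ℕ) → ℂ),
    0 ≤ kF ∧ Function.Injective κ ∧
    Set.range κ = {o | waveVector p o 0 ^ 2 + waveVector p o 1 ^ 2 ≤ kF ^ 2} ∧
    ∀ x n, (Ψ : Amp N) (x, n) = slater κ x * φ n) ∧
  ∀ d : Fin 2, dressedAnnih p N d (Ψ : Amp N) = 0

/-- The Drude term `i ε₀ ω_p² / z`. -/
def drudeTerm (p : Params) (N : ℕ) (z : ℂ) : ℂ :=
  Complex.I * ((p.eps0 * plasmaFreq p N ^ 2 : ℝ) : ℂ) / z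

end CavityQED

end

noncomputable section

namespace CavityQED

variable {p : Params} {N : ℕ}

/-! ### Parameters -/

/-! The Hamiltonian is quadratic in the photons, and the electrons enter it only through functions
of their wave vectors, which are diagonal in the plane-wave basis. A Bogoliubov transformation
absorbs the `A²` term and raises the frequency from `ω` to `ω̃`. The coupling of `A` to the total
momentum is then linear in the dressed mode, and completing the square removes it: with `B_d = b_d -
α_d(x)`, where `α_d(x)` is proportional to the total wave vector, `H = E(x) + ħω̃ ∑_d (B†_d B_d +
1/2)` (`hamiltonian_eq`). The displacement costs the electrons a depolarization shift in `E`. By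
Cauchy–Schwarz this shift is at most the fraction `γ < 1` of the kinetic energy
(`le_electronEnergy`), so `E` has finite sublevel sets and a minimum over the configurations allowed
by Pauli exclusion.

Every admissible `Ψ` is a dressed vacuum (`IsDressedVacuum`): supported on finitely many
configurations of one common energy, and annihilated by both `B_d`. For a minimizer this is read off
from the energy written as a sum of nonnegative terms. For the Fermi disk the symmetry `k ↦ -k`
makes the total momentum, hence `α_d`, vanish on the support.

Both `A_d` and `J_d` have the form `v(x) + g (B_d + B†_d)`. The function `v` commutes with `H` and
with the modes, so it drops out of the commutator, which becomes `g²` times the commutator of a free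
oscillator of frequency `ω̃` (`response_linearOp`). The paramagnetic current sits entirely in `v`,
so the current response is the `A` response times `(e²N/m)²`. The rest is the Laplace transform of a
retarded sine and the study of one rational function (`opticalConductivity_eq`).

The operators are unbounded and the evolution is defined through solutions of the Schrödinger
equation. Only vectors with at most two quanta above a dressed vacuum occur, and these are finite
sums of eigenvectors. Their evolution is therefore explicit (`coe_evolve`), unique because the norm
is conserved, and every product stays square-summable because vacuum amplitudes decay geometrically
in the photon number (`modeAmp_decay`). -/

lemma volume_pos (p : Params) : 0 < volume p :=
  mul_pos (pow_pos p.side_pos 2) p.height_pos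

lemma plasmaFreq_sq (p : Params) (N : ℕ) :
    plasmaFreq p N ^ 2 = p.charge ^ 2 * N / (p.mass * p.eps0 * volume p) := by
  have := volume_pos p
  have := p.mass_pos
  have := p.eps0_pos
  rw [plasmaFreq, Real.sq_sqrt (by unfold density; positivity), density]
  field_simp

lemma plasmaFreq_sq_pos (p : Params) (hN : 1 ≤ N) : 0 < plasmaFreq p N ^ 2 := by
  have := volume_pos p
  have := p.mass_pos
  have := p.eps0_pos
  have := p.charge_ne
  have : 0 < p.charge ^ 2 := by positivity
  have : (0 : ℝ) < N := by exact_mod_cast hN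
  rw [plasmaFreq_sq]
  positivity

lemma dressedFreq_sq (p : Params) (N : ℕ) :
    dressedFreq p N ^ 2 = p.omega ^ 2 + plasmaFreq p N ^ 2 :=
  Real.sq_sqrt (by positivity)

lemma dressedFreq_pos (p : Params) (N : ℕ) : 0 < dressedFreq p N := by
  have := p.omega_pos
  exact Real.sqrt_pos.2 (by positivity)

lemma omega_le_dressedFreq (p : Params) (N : ℕ) : p.omega ≤ dressedFreq p N :=
  Real.le_sqrt_of_sq_le (by nlinarith [sq_nonneg (plasmaFreq p N)])

lemma coupling_pos (p : Params) (hN : 1 ≤ N) : 0 < coupling p N :=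
  div_pos (plasmaFreq_sq_pos p hN) (pow_pos (dressedFreq_pos p N) 2)

lemma coupling_lt_one (p : Params) (N : ℕ) : coupling p N < 1 := by
  rw [coupling, div_lt_one (pow_pos (dressedFreq_pos p N) 2), dressedFreq_sq]
  nlinarith [p.omega_pos]

/-! ### Bogoliubov coefficients `μ`, `ν` of the dressed mode. -/

/-- The coefficient of `a_d` in the dressed annihilation operator. -/
def bogMu (p : Params) (N : ℕ) : ℝ :=
  (dressedFreq p N + p.omega) / (2 * Real.sqrt (p.omega * dressedFreq p N))

/-- The coefficient of `a†_d` in the dressed annihilation operator. -/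
def bogNu (p : Params) (N : ℕ) : ℝ :=
  (dressedFreq p N - p.omega) / (2 * Real.sqrt (p.omega * dressedFreq p N))

/-- The amplitude of the vector potential in terms of the bare mode. -/
def bareAmp (p : Params) : ℝ := Real.sqrt (p.hbar / (2 * p.eps0 * volume p * p.omega))

/-- The amplitude of the vector potential in terms of the dressed mode. -/
def dressedAmp (p : Params) (N : ℕ) : ℝ := bareAmp p / (bogMu p N + bogNu p N)

lemma bareAmp_sq (p : Params) : bareAmp p ^ 2 = p.hbar / (2 * p.eps0 * volume p * p.omega) := by
  have := volume_pos p
  have := p.eps0_pos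
  have := p.omega_pos
  have := p.hbar_pos
  exact Real.sq_sqrt (by positivity)

lemma sqrt_freq_sq (p : Params) (N : ℕ) :
    Real.sqrt (p.omega * dressedFreq p N) ^ 2 = p.omega * dressedFreq p N :=
  Real.sq_sqrt (mul_nonneg p.omega_pos.le (dressedFreq_pos p N).le)

lemma sqrt_freq_pos (p : Params) (N : ℕ) : 0 < Real.sqrt (p.omega * dressedFreq p N) :=
  Real.sqrt_pos.2 (mul_pos p.omega_pos (dressedFreq_pos p N))

lemma bogMu_pos (p : Params) (N : ℕ) : 0 < bogMu p N := by
  have := sqrt_freq_pos p N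
  have := p.omega_pos
  have := dressedFreq_pos p N
  unfold bogMu
  positivity

lemma bogNu_nonneg (p : Params) (N : ℕ) : 0 ≤ bogNu p N := by
  have := sqrt_freq_pos p N
  have := omega_le_dressedFreq p N
  exact div_nonneg (by linarith) (by positivity)

lemma bogNu_lt_bogMu (p : Params) (N : ℕ) : bogNu p N < bogMu p N := by
  have := sqrt_freq_pos p N
  have := p.omega_pos
  unfold bogMu bogNu
  gcongr
  linarith

lemma bogMu_add_bogNu_pos (p : Params) (N : ℕ) : 0 < bogMu p N + bogNu p N :=
  add_pos_of_pos_of_nonneg (bogMu_pos p N) (bogNu_nonneg p N)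

/-- This is what makes the Bogoliubov transformation canonical: `[b, b†] = μ² - ν²`. -/
lemma bogMu_sq_sub (p : Params) (N : ℕ) : bogMu p N ^ 2 - bogNu p N ^ 2 = 1 := by
  have h := (sqrt_freq_pos p N).ne'
  have := p.omega_pos.ne'
  have := (dressedFreq_pos p N).ne'
  unfold bogMu bogNu
  rw [div_pow, div_pow, mul_pow, sqrt_freq_sq]
  field_simp
  ring

/-- Since `b + b† = (μ + ν)(a + a†)`, this factor converts the bare amplitude of the vector
potential into the dressed one, replacing `ω` by `ω̃` in it. -/
lemma bogMu_add_sq (p : Params) (N : ℕ) :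
    (bogMu p N + bogNu p N) ^ 2 = dressedFreq p N / p.omega := by
  have h := (sqrt_freq_pos p N).ne'
  have := p.omega_pos.ne'
  have := (dressedFreq_pos p N).ne'
  unfold bogMu bogNu
  rw [← add_div, div_pow, mul_pow, sqrt_freq_sq]
  field_simp
  ring

/-- Matches the coefficient of `a a` and `a† a†` in `ħω̃ b†b` with the one coming from the `A²`
term. -/
lemma bogMu_mul_bogNu (p : Params) (N : ℕ) :
    p.hbar * dressedFreq p N * (bogMu p N * bogNu p N)
      = N * p.charge ^ 2 / (2 * p.mass) * bareAmp p ^ 2 := by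
  have h := (sqrt_freq_pos p N).ne'
  have h1 := p.omega_pos.ne'
  have h2 := (dressedFreq_pos p N).ne'
  have h3 := (volume_pos p).ne'
  have h4 := p.mass_pos.ne'
  have h5 := p.eps0_pos.ne'
  have e1 : bogMu p N * bogNu p N = plasmaFreq p N ^ 2 / (4 * (p.omega * dressedFreq p N)) := by
    have e : plasmaFreq p N ^ 2 = dressedFreq p N ^ 2 - p.omega ^ 2 := by
      rw [dressedFreq_sq]; ring
    rw [e, bogMu, bogNu, div_mul_div_comm, mul_mul_mul_comm, ← sq (Real.sqrt _), sqrt_freq_sq]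
    congr 1 <;> ring
  rw [e1, plasmaFreq_sq, bareAmp_sq]
  field_simp
  ring

/-- Matches the coefficient of `a†a`: the bare photon energy plus the two mixed terms of `A²`. -/
lemma bogMu_sq_add (p : Params) (N : ℕ) :
    p.hbar * dressedFreq p N * (bogMu p N ^ 2 + bogNu p N ^ 2)
      = p.hbar * p.omega + 2 * (N * p.charge ^ 2 / (2 * p.mass) * bareAmp p ^ 2) := by
  have h2 := (dressedFreq_pos p N).ne'
  have h1 := p.omega_pos.ne'
  have e := bogMu_mul_bogNu p N
  have : bogMu p N ^ 2 + bogNu p N ^ 2 + 2 * (bogMu p N * bogNu p N) =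
    dressedFreq p N / p.omega := by rw [← bogMu_add_sq]; ring
  have e2 : p.hbar * dressedFreq p N * (bogMu p N ^ 2 + bogNu p N ^ 2 +
      2 * (bogMu p N * bogNu p N)) = p.hbar * p.omega + p.hbar * plasmaFreq p N ^ 2 / p.omega := by
    rw [this, mul_div_assoc', mul_assoc, ← sq, dressedFreq_sq]
    field_simp
  have h3 := (volume_pos p).ne'
  have h4 := p.mass_pos.ne'
  have h5 := p.eps0_pos.ne'
  have e3 : p.hbar * plasmaFreq p N ^ 2 / p.omega =
      4 * (N * p.charge ^ 2 / (2 * p.mass) * bareAmp p ^ 2) := by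
    rw [plasmaFreq_sq, bareAmp_sq]
    field_simp
    ring
  linarith

lemma dressedAmp_sq (p : Params) (N : ℕ) :
    dressedAmp p N ^ 2 = p.hbar / (2 * p.eps0 * volume p * dressedFreq p N) := by
  have h1 := p.omega_pos.ne'
  have h2 := (dressedFreq_pos p N).ne'
  rw [dressedAmp, div_pow, bogMu_add_sq, bareAmp_sq]
  field_simp

/-! ### Electronic quantities -/

/-- Component `d` of the total wave vector. -/
def totalWave (p : Params) (x : Fin N → Orbital) (d : Fin 2) : ℝ := ∑ j, waveVector p (x j) d

/-- The sum of the squared wave vectors. -/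
def waveSq (p : Params) (x : Fin N → Orbital) : ℝ := ∑ j, ∑ d, waveVector p (x j) d ^ 2

/-- The displacement of the dressed mode `d` caused by the electrons. -/
def displacement (p : Params) (d : Fin 2) (x : Fin N → Orbital) : ℝ :=
  p.charge / p.mass * dressedAmp p N / dressedFreq p N * totalWave p x d

/-- The electronic energy including the depolarization shift. -/
def electronEnergy (p : Params) (x : Fin N → Orbital) : ℝ :=
  p.hbar ^ 2 / (2 * p.mass) * waveSq p x
    - p.hbar * dressedFreq p N * ∑ d, displacement p d x ^ 2

lemma totalWave_comp (x : Fin N → Orbital) (π : Equiv.Perm (Fin N)) (d : Fin 2) :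
    totalWave p (x ∘ π) d = totalWave p x d :=
  Equiv.sum_comp π fun j => waveVector p (x j) d

lemma waveSq_comp (x : Fin N → Orbital) (π : Equiv.Perm (Fin N)) :
    waveSq p (x ∘ π) = waveSq p x :=
  Equiv.sum_comp π fun j => ∑ d, waveVector p (x j) d ^ 2

lemma displacement_comp (x : Fin N → Orbital) (π : Equiv.Perm (Fin N)) (d : Fin 2) :
    displacement p d (x ∘ π) = displacement p d x := by
  rw [displacement, totalWave_comp, displacement]

lemma electronEnergy_comp (x : Fin N → Orbital) (π : Equiv.Perm (Fin N)) :
    electronEnergy p (x ∘ π) = electronEnergy p x := by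
  simp only [electronEnergy, waveSq_comp, displacement_comp]

lemma waveSq_nonneg (p : Params) (x : Fin N → Orbital) : 0 ≤ waveSq p x :=
  Finset.sum_nonneg fun _ _ => Finset.sum_nonneg fun _ _ => sq_nonneg _

/-- Cauchy–Schwarz over the electrons. The factor `N` turns the single-electron coupling of the
depolarization shift into the collective one. -/
lemma sum_totalWave_sq_le (p : Params) (x : Fin N → Orbital) :
    ∑ d, totalWave p x d ^ 2 ≤ N * waveSq p x := by
  rw [waveSq, Finset.sum_comm, Finset.mul_sum]
  refine Finset.sum_le_sum fun d _ => ?_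
  simpa [totalWave] using
    sq_sum_le_card_mul_sum_sq (s := Finset.univ) (f := fun j => waveVector p (x j) d)

lemma depolarization_eq (p : Params) (x : Fin N → Orbital) :
    p.hbar * dressedFreq p N * ∑ d, displacement p d x ^ 2 =
      p.hbar ^ 2 / (2 * p.mass) *
        (p.charge ^ 2 / (p.mass * p.eps0 * volume p) / dressedFreq p N ^ 2) *
          ∑ d, totalWave p x d ^ 2 := by
  have h2 := (dressedFreq_pos p N).ne'
  have h3 := (volume_pos p).ne'
  have h4 := p.mass_pos.ne'
  have h5 := p.eps0_pos.ne'
  have : ∀ d, displacement p d x ^ 2 =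
      (p.charge / p.mass) ^ 2 * dressedAmp p N ^ 2 / dressedFreq p N ^ 2 *
        totalWave p x d ^ 2 := fun d => by
    rw [displacement]; ring
  simp only [this, ← Finset.mul_sum, dressedAmp_sq]
  field_simp

/-- Stability of the electrons: the prefactor in `depolarization_eq` is `γ/N` times `ħ²/2m`, and the
`N` of Cauchy–Schwarz completes it to `γ`. As `γ < 1`, the energy still controls the kinetic energy.
-/
lemma le_electronEnergy (p : Params) (x : Fin N → Orbital) :
    (1 - coupling p N) * (p.hbar ^ 2 / (2 * p.mass) * waveSq p x) ≤ electronEnergy p x := by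
  have h3 := volume_pos p
  have h4 := p.mass_pos
  have h5 := p.eps0_pos
  have h6 := p.hbar_pos
  rw [electronEnergy, depolarization_eq, coupling, plasmaFreq_sq]
  have := mul_le_mul_of_nonneg_left (sum_totalWave_sq_le p x)
    (show 0 ≤ p.hbar ^ 2 / (2 * p.mass) *
        (p.charge ^ 2 / (p.mass * p.eps0 * volume p) / dressedFreq p N ^ 2) by positivity)
  refine le_trans (le_of_eq ?_) (sub_le_sub_left this _)
  ring

lemma electronEnergy_le (p : Params) (x : Fin N → Orbital) :
    electronEnergy p x ≤ p.hbar ^ 2 / (2 * p.mass) * waveSq p x := by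
  have := dressedFreq_pos p N
  have h6 := p.hbar_pos
  exact sub_le_self _ (mul_nonneg (by positivity) (Finset.sum_nonneg fun _ _ => sq_nonneg _))

lemma electronEnergy_nonneg (p : Params) (x : Fin N → Orbital) : 0 ≤ electronEnergy p x := by
  have h6 := p.hbar_pos
  have h4 := p.mass_pos
  refine le_trans (mul_nonneg ?_ (mul_nonneg (by positivity) (waveSq_nonneg p x)))
    (le_electronEnergy p x)
  linarith [coupling_lt_one p N]

/-! ### Operators -/

/-- Multiplication by a function of the electronic configuration. -/
def electronMul (f : (Fin N → Orbital) → ℝ) : Module.End ℂ (Amp N) where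
  toFun ψ := fun i => (f i.1 : ℂ) * ψ i
  map_add' ψ φ := by ext x; simp [mul_add]
  map_smul' c ψ := by ext x; simp; ring

/-- Addition of a photon of polarization `d`. -/
def addPhoton (d : Fin 2) (i : Idx N) : Idx N := (i.1, Function.update i.2 d (i.2 d + 1))

/-- The annihilation operator of the displaced dressed mode. -/
def polAnnih (p : Params) (N : ℕ) (d : Fin 2) : Module.End ℂ (Amp N) :=
  dressedAnnih p N d - electronMul (displacement p d)

/-- The creation operator of the displaced dressed mode. -/
def polCreat (p : Params) (N : ℕ) (d : Fin 2) : Module.End ℂ (Amp N) :=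
  (bogMu p N : ℂ) • creat N d + (bogNu p N : ℂ) • annih N d - electronMul (displacement p d)

@[simp] lemma electronMul_apply (f : (Fin N → Orbital) → ℝ) (ψ : Amp N) (i : Idx N) :
    electronMul f ψ i = (f i.1 : ℂ) * ψ i := rfl

/-! ### Ladder operators and their commutation relations. -/

lemma annih_apply (d : Fin 2) (ψ : Amp N) (i : Idx N) :
    annih N d ψ i = (Real.sqrt ((i.2 d : ℝ) + 1) : ℂ) * ψ (addPhoton d i) := rfl

lemma creat_apply_addPhoton (d : Fin 2) (ψ : Amp N) (i : Idx N) :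
    creat N d ψ (addPhoton d i) = (Real.sqrt ((i.2 d : ℝ) + 1) : ℂ) * ψ i := by
  simp [creat, addPhoton]

/-- At photon number `0` the truncated subtraction `0 - 1 = 0` would read a wrong amplitude, but the
factor `√0` removes it. -/
lemma creat_apply_of_eq_zero (d : Fin 2) (ψ : Amp N) (i : Idx N) (h : i.2 d = 0) :
    creat N d ψ i = 0 := by
  simp [creat, h]

lemma addPhoton_injective (d : Fin 2) : Function.Injective (addPhoton (N := N) d) := by
  rintro ⟨x, n⟩ ⟨y, m⟩ h
  simp only [addPhoton, Prod.mk.injEq] at h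
  refine Prod.ext h.1 (funext fun d' => ?_)
  have := congrFun h.2 d'
  by_cases hd : d' = d
  · subst hd; simpa using this
  · simpa [hd] using this

lemma exists_addPhoton_eq (d : Fin 2) (i : Idx N) (h : i.2 d ≠ 0) :
    ∃ j, addPhoton d j = i := by
  refine ⟨(i.1, Function.update i.2 d (i.2 d - 1)), Prod.ext rfl ?_⟩
  simp only [addPhoton, Function.update_self, Function.update_idem]
  rw [Nat.sub_add_cancel (Nat.one_le_iff_ne_zero.2 h), Function.update_eq_self]

lemma annih_mul_creat (d : Fin 2) : annih N d * creat N d = creat N d * annih N d + 1 := by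
  refine LinearMap.ext fun ψ => funext fun i => ?_
  have hs : ∀ n : ℕ, (Real.sqrt ((n : ℝ) + 1) : ℂ) * (Real.sqrt ((n : ℝ) + 1) : ℂ) = n + 1 := by
    intro n
    rw [← Complex.ofReal_mul, Real.mul_self_sqrt (by positivity)]
    simp
  simp only [Module.End.mul_apply, LinearMap.add_apply, Module.End.one_apply, Pi.add_apply]
  rw [annih_apply, creat_apply_addPhoton, ← mul_assoc, hs]
  by_cases h : i.2 d = 0
  · rw [creat_apply_of_eq_zero _ _ _ h, h]; simp
  · obtain ⟨j, rfl⟩ := exists_addPhoton_eq d i h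
    rw [creat_apply_addPhoton, annih_apply, ← mul_assoc, hs]
    simp [addPhoton]; ring

lemma annih_comm_annih (d d' : Fin 2) : Commute (annih N d) (annih N d') := by
  rcases eq_or_ne d d' with rfl | h
  · exact Commute.refl _
  refine LinearMap.ext fun ψ => funext fun i => ?_
  simp only [Module.End.mul_apply, annih_apply, addPhoton, Function.update_of_ne h,
    Function.update_of_ne h.symm]
  rw [Function.update_comm h]
  ring

lemma creat_comm_creat (d d' : Fin 2) : Commute (creat N d) (creat N d') := by
  rcases eq_or_ne d d' with rfl | h
  · exact Commute.refl _
  refine LinearMap.ext fun ψ => funext fun i => ?_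
  simp only [Module.End.mul_apply, creat, LinearMap.coe_mk, AddHom.coe_mk,
    Function.update_of_ne h, Function.update_of_ne h.symm]
  rw [Function.update_comm h]
  ring

lemma annih_comm_creat {d d' : Fin 2} (h : d ≠ d') : Commute (annih N d) (creat N d') := by
  refine LinearMap.ext fun ψ => funext fun i => ?_
  simp only [Module.End.mul_apply, creat, annih, LinearMap.coe_mk, AddHom.coe_mk,
    Function.update_of_ne h, Function.update_of_ne h.symm]
  rw [Function.update_comm h]
  ring

lemma electronMul_comm (f g : (Fin N → Orbital) → ℝ) :
    Commute (electronMul f) (electronMul g) := by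
  refine LinearMap.ext fun ψ => funext fun i => ?_
  simp [mul_left_comm]

lemma electronMul_comm_annih (f : (Fin N → Orbital) → ℝ) (d : Fin 2) :
    Commute (electronMul f) (annih N d) := by
  refine LinearMap.ext fun ψ => funext fun i => ?_
  simp [annih_apply, addPhoton, mul_left_comm]

lemma electronMul_comm_creat (f : (Fin N → Orbital) → ℝ) (d : Fin 2) :
    Commute (electronMul f) (creat N d) := by
  refine LinearMap.ext fun ψ => funext fun i => ?_
  simp [creat, mul_left_comm]

lemma dressedAnnih_eq (p : Params) (N : ℕ) (d : Fin 2) :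
    dressedAnnih p N d = (bogMu p N : ℂ) • annih N d + (bogNu p N : ℂ) • creat N d := by
  rw [dressedAnnih, smul_add, smul_smul, smul_smul, bogMu, bogNu]
  congr 2 <;> push_cast <;> ring

lemma electronMul_comm_polAnnih (f : (Fin N → Orbital) → ℝ) (d : Fin 2) :
    Commute (electronMul f) (polAnnih p N d) := by
  rw [polAnnih, dressedAnnih_eq]
  exact (((electronMul_comm_annih f d).smul_right _).add_right
    ((electronMul_comm_creat f d).smul_right _)).sub_right (electronMul_comm _ _)

lemma electronMul_comm_polCreat (f : (Fin N → Orbital) → ℝ) (d : Fin 2) :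
    Commute (electronMul f) (polCreat p N d) :=
  (((electronMul_comm_creat f d).smul_right _).add_right
    ((electronMul_comm_annih f d).smul_right _)).sub_right (electronMul_comm _ _)

lemma polAnnih_comm_polCreat {d d' : Fin 2} (h : d ≠ d') :
    Commute (polAnnih p N d) (polCreat p N d') := by
  rw [polAnnih, dressedAnnih_eq, polCreat]
  refine Commute.sub_left ?_ (electronMul_comm_polCreat _ _)
  refine Commute.sub_right (Commute.add_left ?_ ?_) ?_
  · exact (((annih_comm_creat h).smul_right _).add_right
      ((annih_comm_annih _ _).smul_right _)).smul_left _
  · exact (((creat_comm_creat _ _).smul_right _).add_right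
      ((annih_comm_creat h.symm).symm.smul_right _)).smul_left _
  · exact (((electronMul_comm_annih _ d).smul_right _).add_right
      ((electronMul_comm_creat _ d).smul_right _)).symm

/-- The displacement is a function of the electrons and commutes with the photon operators, so only
`μ² - ν²` survives in the commutator. -/
lemma polAnnih_mul_polCreat (d : Fin 2) :
    polAnnih p N d * polCreat p N d = polCreat p N d * polAnnih p N d + 1 := by
  have h : (bogMu p N : ℂ) ^ 2 - (bogNu p N : ℂ) ^ 2 = 1 := by
    exact_mod_cast bogMu_sq_sub p N
  have e1 := annih_mul_creat (N := N) d
  have e2 := (electronMul_comm_annih (displacement (N := N) p d) d).eq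
  have e3 := (electronMul_comm_creat (displacement (N := N) p d) d).eq
  rw [polAnnih, dressedAnnih_eq, polCreat]
  simp only [mul_add, add_mul, mul_sub, sub_mul, smul_mul_assoc, mul_smul_comm, e1, e2, e3,
    smul_add]
  linear_combination (norm := module) h • (1 : Module.End ℂ (Amp N))

/-! ### Diagonalization of the Hamiltonian in the displaced dressed modes. -/

lemma vecPot_eq (p : Params) (N : ℕ) (d : Fin 2) :
    vecPot p N d = (dressedAmp p N : ℂ) •
      (polAnnih p N d + polCreat p N d + (2 : ℂ) • electronMul (displacement p d)) := by
  have h : (dressedAmp p N : ℂ) * (bogMu p N + bogNu p N) = bareAmp p := by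
    rw [dressedAmp]
    have := (bogMu_add_bogNu_pos p N).ne'
    exact_mod_cast div_mul_cancel₀ _ this
  rw [vecPot, ← bareAmp, ← h, polAnnih, dressedAnnih_eq, polCreat]
  module

/-- Plane waves diagonalize the derivatives, so the paramagnetic current is a conserved function of
the total momentum. -/
lemma currentPara_eq (p : Params) (N : ℕ) (d : Fin 2) :
    currentPara p N d =
      electronMul fun x => p.charge * p.hbar / p.mass * totalWave p x d := by
  refine LinearMap.ext fun ψ => funext fun i => ?_
  simp only [currentPara, nabla, LinearMap.smul_apply, LinearMap.sum_apply, LinearMap.coe_mk,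
    AddHom.coe_mk, Pi.smul_apply, Finset.sum_apply, smul_eq_mul, electronMul_apply, totalWave,
    ← Finset.sum_mul, ← Finset.mul_sum]
  push_cast
  linear_combination (-(p.charge * p.hbar / p.mass) * (∑ j, (waveVector p (i.1 j) d : ℂ)) * ψ i)
    * Complex.I_mul_I

lemma kinetic_eq (p : Params) (N : ℕ) :
    kinetic p N = electronMul fun x => p.hbar ^ 2 / (2 * p.mass) * waveSq p x := by
  refine LinearMap.ext fun ψ => funext fun i => ?_
  have : ∀ j d, nabla p N j d (nabla p N j d ψ) i = -((waveVector p (i.1 j) d : ℂ) ^ 2 * ψ i) := by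
    intro j d
    simp only [nabla, LinearMap.coe_mk, AddHom.coe_mk]
    linear_combination ((waveVector p (i.1 j) d : ℂ) ^ 2 * ψ i) * Complex.I_mul_I
  simp only [kinetic, LinearMap.smul_apply, LinearMap.sum_apply, Module.End.mul_apply,
    Pi.smul_apply, Finset.sum_apply, smul_eq_mul, electronMul_apply, waveSq, this,
    Finset.sum_neg_distrib, ← Finset.sum_mul]
  push_cast
  ring

lemma photonEnergy_apply (p : Params) (ψ : Amp N) (i : Idx N) :
    photonEnergy p N ψ i = ((p.hbar * p.omega * (∑ d, (i.2 d : ℝ) + 1) : ℝ) : ℂ) * ψ i := by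
  have : ∀ d, creat N d (annih N d ψ) i = (i.2 d : ℂ) * ψ i := by
    intro d
    by_cases h : i.2 d = 0
    · rw [creat_apply_of_eq_zero _ _ _ h, h]; simp
    · obtain ⟨j, rfl⟩ := exists_addPhoton_eq d i h
      rw [creat_apply_addPhoton, annih_apply, ← mul_assoc, ← Complex.ofReal_mul,
        Real.mul_self_sqrt (by positivity)]
      simp [addPhoton]
  simp only [photonEnergy, LinearMap.smul_apply, LinearMap.add_apply,
    Module.End.mul_apply, Pi.smul_apply, Pi.add_apply, Module.End.one_apply,
    smul_eq_mul, this, Fin.sum_univ_two]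
  push_cast
  ring

/-- The displacement is chosen for this identity: `A` times the paramagnetic current is the cross
term `ħω̃ α (b + b†)` of the completed square. -/
lemma bareAmp_mul_currentPara (p : Params) (N : ℕ) (d : Fin 2) :
    (bareAmp p : ℂ) • currentPara p N d =
      ((p.hbar * dressedFreq p N * (bogMu p N + bogNu p N) : ℝ) : ℂ) •
        electronMul (displacement p d) := by
  have h1 := (bogMu_add_bogNu_pos p N).ne'
  have h2 := (dressedFreq_pos p N).ne'
  refine LinearMap.ext fun ψ => funext fun i => ?_
  rw [currentPara_eq]
  simp only [LinearMap.smul_apply, Pi.smul_apply, electronMul_apply, smul_eq_mul, ← mul_assoc,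
    ← Complex.ofReal_mul]
  congr 2
  rw [displacement, dressedAmp]
  field_simp

lemma electronMul_electronEnergy (p : Params) (N : ℕ) :
    electronMul (N := N) (electronEnergy p) = kinetic p N -
      ((p.hbar * dressedFreq p N : ℝ) : ℂ) •
        ∑ d, electronMul (displacement p d) * electronMul (displacement p d) := by
  refine LinearMap.ext fun ψ => funext fun i => ?_
  rw [kinetic_eq]
  simp only [LinearMap.sub_apply, Pi.sub_apply, LinearMap.smul_apply, Pi.smul_apply,
    electronMul_apply, smul_eq_mul, electronEnergy, Fin.sum_univ_two, LinearMap.add_apply,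
    Module.End.mul_apply, Pi.add_apply]
  push_cast
  ring

/-- Completing the square in one polarization, with the remainder `-ħω̃ α²` left to the electronic
energy. -/
lemma mode_energy_eq (p : Params) (N : ℕ) (d : Fin 2) :
    ((N * p.charge ^ 2 / (2 * p.mass) : ℝ) : ℂ) • (vecPot p N d * vecPot p N d)
      + ((p.hbar * p.omega : ℝ) : ℂ) • (creat N d * annih N d + (1 / 2 : ℂ) • 1)
      - vecPot p N d * currentPara p N d =
    ((p.hbar * dressedFreq p N : ℝ) : ℂ) • (polCreat p N d * polAnnih p N d + (1 / 2 : ℂ) • 1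
      - electronMul (displacement p d) * electronMul (displacement p d)) := by
  have h : (bogMu p N : ℂ) ^ 2 - (bogNu p N : ℂ) ^ 2 = 1 := by
    exact_mod_cast bogMu_sq_sub p N
  have hm : (p.hbar * dressedFreq p N * (bogMu p N * bogNu p N) : ℂ)
      = N * p.charge ^ 2 / (2 * p.mass) * bareAmp p ^ 2 := by
    exact_mod_cast bogMu_mul_bogNu p N
  have hs : (p.hbar * dressedFreq p N * (bogMu p N ^ 2 + bogNu p N ^ 2) : ℂ)
      = p.hbar * p.omega + 2 * (N * p.charge ^ 2 / (2 * p.mass) * bareAmp p ^ 2) := by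
    exact_mod_cast bogMu_sq_add p N
  have e1 := annih_mul_creat (N := N) d
  have e2 := (electronMul_comm_annih (displacement (N := N) p d) d).eq
  have e3 := (electronMul_comm_creat (displacement (N := N) p d) d).eq
  have hp : vecPot p N d * currentPara p N d = (annih N d + creat N d) *
      ((p.hbar * dressedFreq p N * (bogMu p N + bogNu p N) : ℝ) : ℂ) •
        electronMul (displacement p d) := by
    rw [← bareAmp_mul_currentPara, vecPot, ← bareAmp, smul_mul_assoc, mul_smul_comm]
  rw [hp, vecPot, ← bareAmp, polAnnih, dressedAnnih_eq, polCreat]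
  simp only [mul_add, add_mul, mul_sub, sub_mul, smul_mul_assoc, mul_smul_comm, e1, e2, e3,
    smul_add, smul_sub]
  push_cast
  -- After normal ordering, `hm` settles `a a` and `a† a†`, and `hs` settles `a†a`. The dressed
  -- constant is `ν² + 1/2 = (μ² + ν²)/2` by `h`, so half of `hs` also settles the constants.
  linear_combination (norm := module) (-hm) • (annih N d * annih N d) - hm • (creat N d * creat N d)
    - hs • (creat N d * annih N d) - (hs / 2) • (1 : Module.End ℂ (Amp N))
    + ((p.hbar * dressedFreq p N / 2 : ℂ) * h) • (1 : Module.End ℂ (Amp N))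

lemma hamiltonian_eq (p : Params) (N : ℕ) :
    hamiltonian p N = electronMul (electronEnergy p) +
      ((p.hbar * dressedFreq p N : ℝ) : ℂ) •
        ∑ d, (polCreat p N d * polAnnih p N d + (1 / 2 : ℂ) • 1) := by
  have hc : (Complex.I * ((p.charge * p.hbar / p.mass : ℝ) : ℂ)) •
      (∑ j : Fin N, ∑ d : Fin 2, vecPot p N d * nabla p N j d) =
      -∑ d, vecPot p N d * currentPara p N d := by
    rw [Finset.sum_comm]
    simp only [currentPara, ← Finset.mul_sum, neg_smul, mul_smul_comm, neg_neg, ← Finset.smul_sum]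
  have h0 := mode_energy_eq p N 0
  have h1 := mode_energy_eq p N 1
  rw [hamiltonian, hc, electronMul_electronEnergy, photonEnergy]
  simp only [Fin.sum_univ_two, smul_add, smul_sub] at h0 h1 ⊢
  linear_combination (norm := module) h0 + h1

/-! ### Weighted spaces of amplitudes -/

/-- The square root of one plus the squared wave vectors plus the number of photons. -/
def weight (p : Params) (i : Idx N) : ℝ :=
  Real.sqrt (1 + waveSq p i.1 + ∑ d, (i.2 d : ℝ))

lemma photonNumber_nonneg (i : Idx N) : 0 ≤ ∑ d, (i.2 d : ℝ) :=
  Finset.sum_nonneg fun _ _ => Nat.cast_nonneg _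

lemma weight_sq (p : Params) (i : Idx N) :
    weight p i ^ 2 = 1 + waveSq p i.1 + ∑ d, (i.2 d : ℝ) :=
  Real.sq_sqrt (by linarith [waveSq_nonneg p i.1, photonNumber_nonneg i])

lemma one_le_weight (p : Params) (i : Idx N) : 1 ≤ weight p i :=
  Real.le_sqrt_of_sq_le (by linarith [waveSq_nonneg p i.1, photonNumber_nonneg i])

lemma weight_pos (p : Params) (i : Idx N) : 0 < weight p i :=
  one_pos.trans_le (one_le_weight p i)

lemma photonNumber_addPhoton (d : Fin 2) (i : Idx N) :
    ∑ d', ((addPhoton d i).2 d' : ℝ) = ∑ d', (i.2 d' : ℝ) + 1 := by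
  fin_cases d <;> simp [addPhoton, Fin.sum_univ_two] <;> ring

lemma weight_addPhoton_le (p : Params) (d : Fin 2) (i : Idx N) :
    weight p (addPhoton d i) ≤ 2 * weight p i := by
  refine le_of_sq_le_sq ?_ (by linarith [weight_pos p i])
  rw [mul_pow, weight_sq, weight_sq, photonNumber_addPhoton]
  have : (addPhoton d i).1 = i.1 := rfl
  rw [this]
  linarith [waveSq_nonneg p i.1, photonNumber_nonneg i]

lemma weight_le_addPhoton (p : Params) (d : Fin 2) (i : Idx N) :
    weight p i ≤ weight p (addPhoton d i) := by
  refine Real.sqrt_le_sqrt ?_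
  rw [photonNumber_addPhoton]
  have : (addPhoton d i).1 = i.1 := rfl
  rw [this]
  linarith

lemma sqrt_le_weight (p : Params) (d : Fin 2) (i : Idx N) :
    Real.sqrt ((i.2 d : ℝ) + 1) ≤ weight p i := by
  refine Real.sqrt_le_sqrt ?_
  have : (i.2 d : ℝ) ≤ ∑ d', (i.2 d' : ℝ) :=
    Finset.single_le_sum (f := fun d' => (i.2 d' : ℝ)) (fun _ _ => Nat.cast_nonneg _)
      (Finset.mem_univ d)
  linarith [waveSq_nonneg p i.1]

lemma memℓp_two_iff {ψ : Amp N} :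
    Memℓp (ψ : (i : Idx N) → (fun _ => ℂ) i) 2 ↔ Summable fun i => ‖ψ i‖ ^ 2 := by
  rw [memℓp_gen_iff (by norm_num)]
  simp

/-- Amplitudes that are square-summable with the `k`-th power of the weight. -/
def weighted (p : Params) (N k : ℕ) : Submodule ℂ (Amp N) where
  carrier := {ψ | Memℓp (fun i => ((weight p i ^ k : ℝ) : ℂ) * ψ i :
    (i : Idx N) → (fun _ => ℂ) i) 2}
  zero_mem' := by
    simp only [Set.mem_ofPred_eq, Pi.zero_apply, mul_zero]
    exact zero_memℓp
  add_mem' h h' := by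
    simp only [Set.mem_ofPred_eq, Pi.add_apply, mul_add] at h h' ⊢
    exact h.add h'
  smul_mem' c ψ h := by
    simp only [Set.mem_ofPred_eq, Pi.smul_apply] at h ⊢
    convert h.const_smul c using 1
    ext i
    simp [mul_left_comm]

lemma mem_weighted {k : ℕ} {ψ : Amp N} :
    ψ ∈ weighted p N k ↔ Summable fun i => (weight p i ^ k * ‖ψ i‖) ^ 2 := by
  refine Iff.trans (memℓp_two_iff (ψ := fun i => ((weight p i ^ k : ℝ) : ℂ) * ψ i)) ?_
  refine summable_congr fun i => ?_
  rw [norm_mul, Complex.norm_of_nonneg (pow_nonneg (weight_pos p i).le k)]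

lemma mem_weighted_zero {ψ : Amp N} :
    ψ ∈ weighted p N 0 ↔ Memℓp (ψ : (i : Idx N) → (fun _ => ℂ) i) 2 := by
  rw [mem_weighted, memℓp_two_iff]
  simp

lemma coe_mem_weighted (p : Params) (ψ : State N) : (ψ : Amp N) ∈ weighted p N 0 :=
  mem_weighted_zero.2 (lp.memℓp ψ)

lemma mem_weighted_of_le {k l : ℕ} {φ ψ : Amp N} (c : ℝ)
    (h : ∀ i, weight p i ^ k * ‖φ i‖ ≤ c * (weight p i ^ l * ‖ψ i‖))
    (hψ : ψ ∈ weighted p N l) : φ ∈ weighted p N k := by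
  rw [mem_weighted] at hψ ⊢
  refine Summable.of_nonneg_of_le (fun i => sq_nonneg _) (fun i => ?_) (hψ.mul_left (c ^ 2))
  rw [← mul_pow]
  exact pow_le_pow_left₀ (mul_nonneg (pow_nonneg (weight_pos p i).le _) (norm_nonneg _)) (h i) 2

lemma weighted_antitone (p : Params) (N : ℕ) : Antitone (weighted p N) := by
  intro k l hkl ψ hψ
  refine mem_weighted_of_le 1 (fun i => ?_) hψ
  rw [one_mul]
  exact mul_le_mul_of_nonneg_right (pow_le_pow_right₀ (one_le_weight p i) hkl) (norm_nonneg _)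

/-- A ladder operator costs one power of the weight, because its matrix elements `√(n + 1)` are
bounded by the weight. -/
lemma annih_mem_weighted {k : ℕ} {ψ : Amp N} (d : Fin 2) (hψ : ψ ∈ weighted p N (k + 1)) :
    annih N d ψ ∈ weighted p N k := by
  rw [mem_weighted] at hψ ⊢
  refine Summable.of_nonneg_of_le (fun i => sq_nonneg _) (fun i => ?_)
    (hψ.comp_injective (addPhoton_injective d))
  have hw := weight_pos p i
  rw [annih_apply, norm_mul, Complex.norm_of_nonneg (Real.sqrt_nonneg _), ← mul_assoc]
  refine pow_le_pow_left₀ (by positivity) (mul_le_mul_of_nonneg_right ?_ (norm_nonneg _)) 2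
  rw [pow_succ]
  refine mul_le_mul (pow_le_pow_left₀ hw.le (weight_le_addPhoton p d i) k) ?_
    (Real.sqrt_nonneg _) (pow_nonneg (weight_pos p _).le k)
  · exact (sqrt_le_weight p d i).trans (weight_le_addPhoton p d i)

lemma creat_mem_weighted {k : ℕ} {ψ : Amp N} (d : Fin 2) (hψ : ψ ∈ weighted p N (k + 1)) :
    creat N d ψ ∈ weighted p N k := by
  rw [mem_weighted] at hψ ⊢
  -- The amplitude vanishes where there is no photon, so the sum runs over the range of `addPhoton`.
  -- Shifting back changes the weight by at most a factor `2`.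
  rw [← (addPhoton_injective d).summable_iff]
  · refine Summable.of_nonneg_of_le (fun i => sq_nonneg _) (fun i => ?_)
      (hψ.mul_left ((2 ^ k) ^ 2))
    have hw := weight_pos p i
    have hw' := weight_pos p (addPhoton d i)
    rw [Function.comp_apply, creat_apply_addPhoton, norm_mul,
      Complex.norm_of_nonneg (Real.sqrt_nonneg _), ← mul_assoc, ← mul_pow, ← mul_assoc]
    refine pow_le_pow_left₀ (by positivity) (mul_le_mul_of_nonneg_right ?_ (norm_nonneg _)) 2
    rw [pow_succ, ← mul_assoc, ← mul_pow]
    gcongr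
    · exact weight_addPhoton_le p d i
    · exact sqrt_le_weight p d i
  · intro i hi
    have : i.2 d = 0 := by
      by_contra h
      exact hi (exists_addPhoton_eq d i h)
    simp [creat_apply_of_eq_zero d ψ i this]

/-- Here `m` counts the powers of the weight that are lost: one for the displacement, two for the
electronic energy. -/
lemma electronMul_mem_weighted {k m : ℕ} {ψ : Amp N} {f : (Fin N → Orbital) → ℝ} {c : ℝ}
    (hf : ∀ i : Idx N, |f i.1| ≤ c * weight p i ^ m) (hψ : ψ ∈ weighted p N (k + m)) :
    electronMul f ψ ∈ weighted p N k := by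
  refine mem_weighted_of_le c (fun i => ?_) hψ
  have hw := weight_pos p i
  rw [electronMul_apply, norm_mul, Complex.norm_real, Real.norm_eq_abs, pow_add]
  calc weight p i ^ k * (|f i.1| * ‖ψ i‖) ≤ weight p i ^ k * (c * weight p i ^ m * ‖ψ i‖) := by
        gcongr; exact hf i
    _ = _ := by ring

lemma abs_totalWave_le (p : Params) (d : Fin 2) (i : Idx N) :
    |totalWave p i.1 d| ≤ Real.sqrt N * weight p i ^ 1 := by
  rw [pow_one]
  refine abs_le_of_sq_le_sq ?_ (mul_nonneg (Real.sqrt_nonneg _) (weight_pos p i).le)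
  rw [mul_pow, Real.sq_sqrt (Nat.cast_nonneg _), weight_sq]
  have h1 : totalWave p i.1 d ^ 2 ≤ ∑ d', totalWave p i.1 d' ^ 2 :=
    Finset.single_le_sum (f := fun d' => totalWave p i.1 d' ^ 2) (fun _ _ => sq_nonneg _)
      (Finset.mem_univ d)
  refine h1.trans ((sum_totalWave_sq_le p i.1).trans ?_)
  gcongr
  linarith [photonNumber_nonneg i]

lemma abs_displacement_le (p : Params) (d : Fin 2) (i : Idx N) :
    |displacement p d i.1| ≤
      |p.charge / p.mass * dressedAmp p N / dressedFreq p N| * Real.sqrt N * weight p i ^ 1 := by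
  rw [displacement, abs_mul, mul_assoc]
  exact mul_le_mul_of_nonneg_left (abs_totalWave_le p d i) (abs_nonneg _)

lemma abs_electronEnergy_le (p : Params) (i : Idx N) :
    |electronEnergy p i.1| ≤ p.hbar ^ 2 / (2 * p.mass) * weight p i ^ 2 := by
  have := p.mass_pos
  rw [abs_of_nonneg (electronEnergy_nonneg p i.1)]
  refine (electronEnergy_le p i.1).trans ?_
  rw [weight_sq]
  gcongr
  linarith [photonNumber_nonneg i]

lemma polAnnih_mem_weighted {k : ℕ} {ψ : Amp N} (d : Fin 2) (hψ : ψ ∈ weighted p N (k + 1)) :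
    polAnnih p N d ψ ∈ weighted p N k := by
  rw [polAnnih, dressedAnnih_eq]
  exact Submodule.sub_mem _ (Submodule.add_mem _
    (Submodule.smul_mem _ _ (annih_mem_weighted d hψ))
    (Submodule.smul_mem _ _ (creat_mem_weighted d hψ)))
    (electronMul_mem_weighted (abs_displacement_le p d) hψ)

lemma polCreat_mem_weighted {k : ℕ} {ψ : Amp N} (d : Fin 2) (hψ : ψ ∈ weighted p N (k + 1)) :
    polCreat p N d ψ ∈ weighted p N k :=
  Submodule.sub_mem _ (Submodule.add_mem _
    (Submodule.smul_mem _ _ (creat_mem_weighted d hψ))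
    (Submodule.smul_mem _ _ (annih_mem_weighted d hψ)))
    (electronMul_mem_weighted (abs_displacement_le p d) hψ)

lemma hamiltonian_apply (p : Params) (ψ : Amp N) :
    hamiltonian p N ψ = electronMul (electronEnergy p) ψ +
      ((p.hbar * dressedFreq p N : ℝ) : ℂ) •
        (∑ d, polCreat p N d (polAnnih p N d ψ) + ψ) := by
  rw [hamiltonian_eq]
  simp only [Fin.sum_univ_two, LinearMap.add_apply, LinearMap.smul_apply, Module.End.mul_apply,
    Module.End.one_apply]
  module

lemma hamiltonian_mem_weighted {k : ℕ} {ψ : Amp N} (hψ : ψ ∈ weighted p N (k + 2)) :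
    hamiltonian p N ψ ∈ weighted p N k := by
  rw [hamiltonian_apply]
  exact Submodule.add_mem _ (electronMul_mem_weighted (abs_electronEnergy_le p) hψ)
    (Submodule.smul_mem _ _ (Submodule.add_mem _
      (Submodule.sum_mem _ fun d _ => polCreat_mem_weighted d (polAnnih_mem_weighted d hψ))
      (weighted_antitone p N (Nat.le_add_right k 2) hψ)))

/-! ### Antisymmetric amplitudes -/

/-- The antisymmetric amplitudes. -/
def fermionic (N : ℕ) : Submodule ℂ (Amp N) where
  carrier := {ψ | IsFermionic ψ}
  zero_mem' := fun π x n => by simp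
  add_mem' h h' := fun π x n => by
    simp only [Pi.add_apply, h π x n, h' π x n, mul_add]
  smul_mem' c ψ h := fun π x n => by
    simp only [Pi.smul_apply, h π x n, smul_eq_mul, mul_left_comm]

lemma mem_fermionic {ψ : Amp N} : ψ ∈ fermionic N ↔ IsFermionic ψ := Iff.rfl

lemma annih_mem_fermionic {ψ : Amp N} (d : Fin 2) (h : ψ ∈ fermionic N) :
    annih N d ψ ∈ fermionic N := fun π x n => by
  simp only [annih_apply, addPhoton]
  rw [h π x _, mul_left_comm]

lemma creat_mem_fermionic {ψ : Amp N} (d : Fin 2) (h : ψ ∈ fermionic N) :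
    creat N d ψ ∈ fermionic N := fun π x n => by
  simp only [creat, LinearMap.coe_mk, AddHom.coe_mk]
  rw [h π x _, mul_left_comm]

lemma electronMul_mem_fermionic {ψ : Amp N} {f : (Fin N → Orbital) → ℝ}
    (hf : ∀ x (π : Equiv.Perm (Fin N)), f (x ∘ π) = f x) (h : ψ ∈ fermionic N) :
    electronMul f ψ ∈ fermionic N := fun π x n => by
  simp only [electronMul_apply]
  rw [h π x _, hf, mul_left_comm]

lemma polCreat_mem_fermionic {ψ : Amp N} (d : Fin 2) (h : ψ ∈ fermionic N) :
    polCreat p N d ψ ∈ fermionic N :=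
  Submodule.sub_mem _ (Submodule.add_mem _
    (Submodule.smul_mem _ _ (creat_mem_fermionic d h))
    (Submodule.smul_mem _ _ (annih_mem_fermionic d h)))
    (electronMul_mem_fermionic (fun x π => displacement_comp x π d) h)

/-- Pauli exclusion: exchanging two electrons in the same orbital fixes the configuration but flips
the sign. Energies therefore need to be minimized over injective configurations only. -/
lemma IsFermionic.apply_eq_zero {ψ : Amp N} (h : IsFermionic ψ) {x : Fin N → Orbital}
    (hx : ¬ Function.Injective x) (n : Fin 2 → ℕ) : ψ (x, n) = 0 := by
  simp only [Function.Injective, not_forall] at hx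
  obtain ⟨i, j, hij, hne⟩ := hx
  have hc : x ∘ Equiv.swap i j = x := by
    funext k
    simp only [Function.comp_apply, Equiv.swap_apply_def]
    split_ifs with h1 h2
    · rw [h1, hij]
    · rw [h2, hij]
    · rfl
  have := h (Equiv.swap i j) x n
  rw [hc, Equiv.Perm.sign_swap hne] at this
  simp only [Units.val_neg, Units.val_one, Int.cast_neg, Int.cast_one, neg_mul, one_mul] at this
  exact self_eq_neg.1 this

/-! ### The domain of the Hamiltonian -/

/-- Kinetic and photon energy are both multiplication operators in this basis. Divided by their
constants they add up to exactly the squared weight, and each is dominated by it. -/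
lemma inDomain_iff {ψ : State N} :
    InDomain p N ψ ↔ (ψ : Amp N) ∈ fermionic N ⊓ weighted p N 2 := by
  have hm := p.mass_pos
  have hh := p.hbar_pos
  have ho := p.omega_pos
  rw [Submodule.mem_inf, mem_fermionic, InDomain]
  refine and_congr_right fun _ => ⟨fun ⟨hk, hp⟩ => ?_, fun h => ⟨?_, ?_⟩⟩
  · rw [← mem_weighted_zero (p := p)] at hk hp
    have := Submodule.add_mem _
      (Submodule.smul_mem _ (((p.hbar ^ 2 / (2 * p.mass))⁻¹ : ℝ) : ℂ) hk)
      (Submodule.smul_mem _ (((p.hbar * p.omega)⁻¹ : ℝ) : ℂ) hp)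
    refine mem_weighted_of_le 1 (fun i => le_of_eq ?_) this
    rw [kinetic_eq]
    simp only [Pi.add_apply, Pi.smul_apply, electronMul_apply, photonEnergy_apply, smul_eq_mul,
      ← mul_assoc, ← Complex.ofReal_mul, ← add_mul, ← Complex.ofReal_add]
    have e : (p.hbar ^ 2 / (2 * p.mass))⁻¹ * (p.hbar ^ 2 / (2 * p.mass)) * waveSq p i.1 +
        (p.hbar * p.omega)⁻¹ * (p.hbar * p.omega) * (∑ d, (i.2 d : ℝ) + 1) =
        weight p i ^ 2 := by
      rw [inv_mul_cancel₀ (by positivity), inv_mul_cancel₀ (by positivity), weight_sq]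
      ring
    simp only [← mul_assoc] at e
    rw [norm_mul, e, Complex.norm_of_nonneg (sq_nonneg _), pow_zero, one_mul, one_mul]
  · rw [← mem_weighted_zero (p := p), kinetic_eq]
    refine electronMul_mem_weighted (m := 2) (c := p.hbar ^ 2 / (2 * p.mass)) (fun i => ?_) h
    rw [weight_sq, abs_of_nonneg (mul_nonneg (by positivity) (waveSq_nonneg p i.1))]
    gcongr
    linarith [photonNumber_nonneg i]
  · rw [← mem_weighted_zero (p := p)]
    refine mem_weighted_of_le (p.hbar * p.omega) (fun i => ?_) h
    have := photonNumber_nonneg i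
    rw [photonEnergy_apply, norm_mul, Complex.norm_of_nonneg (by positivity), weight_sq, pow_zero,
      one_mul, ← mul_assoc]
    refine mul_le_mul_of_nonneg_right (mul_le_mul_of_nonneg_left ?_ (by positivity))
      (norm_nonneg _)
    linarith [waveSq_nonneg p i.1]

lemma coe_applyOp {O : Module.End ℂ (Amp N)} {ψ : State N}
    (h : O (ψ : Amp N) ∈ weighted p N 0) : (applyOp O ψ : Amp N) = O (ψ : Amp N) := by
  rw [applyOp, dif_pos (mem_weighted_zero.1 h)]

/-- A square-summable amplitude as a state. -/
def toState {ψ : Amp N} (h : ψ ∈ weighted p N 0) : State N := ⟨ψ, mem_weighted_zero.1 h⟩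

@[simp] lemma coe_toState {ψ : Amp N} (h : ψ ∈ weighted p N 0) :
    (toState h : Amp N) = ψ := rfl

lemma state_ext {φ ψ : State N} (h : (φ : Amp N) = (ψ : Amp N)) : φ = ψ := lp.ext h

/-! ### The inner product of amplitudes -/

/-- The inner product of amplitudes. -/
def pairing (φ ψ : Amp N) : ℂ := ∑' i, inner ℂ (φ i) (ψ i)

lemma inner_eq_pairing (φ ψ : State N) : inner ℂ φ ψ = pairing (φ : Amp N) (ψ : Amp N) :=
  lp.inner_eq_tsum φ ψ

lemma pairing_self (ψ : Amp N) : pairing ψ ψ = ((∑' i, ‖ψ i‖ ^ 2 : ℝ) : ℂ) := by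
  rw [pairing, Complex.ofReal_tsum]
  refine tsum_congr fun i => ?_
  rw [inner_self_eq_norm_sq_to_K]
  push_cast
  rfl

lemma norm_sq_eq (ψ : State N) : ‖ψ‖ ^ 2 = ∑' i, ‖(ψ : Amp N) i‖ ^ 2 := by
  have := inner_self_eq_norm_sq_to_K (𝕜 := ℂ) ψ
  rw [inner_eq_pairing, pairing_self] at this
  exact Complex.ofReal_injective ((Complex.ofReal_pow _ _).trans this.symm)

lemma pairing_conj_symm (φ ψ : Amp N) : (starRingEnd ℂ) (pairing φ ψ) = pairing ψ φ := by
  rw [pairing, pairing, Complex.conj_tsum]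
  exact tsum_congr fun i => inner_conj_symm _ _

lemma pairing_add {φ ψ χ : Amp N} (hφ : φ ∈ weighted p N 0) (hψ : ψ ∈ weighted p N 0)
    (hχ : χ ∈ weighted p N 0) : pairing φ (ψ + χ) = pairing φ ψ + pairing φ χ := by
  have := inner_add_right (𝕜 := ℂ) (toState hφ) (toState hψ) (toState hχ)
  simpa only [inner_eq_pairing, lp.coeFn_add, coe_toState] using this

/-- No summability is needed: scalars of a field pass through `tsum` in any case, unlike sums of
amplitudes. -/
lemma pairing_smul (c : ℂ) (φ ψ : Amp N) : pairing φ (c • ψ) = c * pairing φ ψ := by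
  rw [pairing, pairing, ← tsum_mul_left]
  exact tsum_congr fun i => inner_smul_right _ _ _

lemma pairing_sub {φ ψ χ : Amp N} (hφ : φ ∈ weighted p N 0) (hψ : ψ ∈ weighted p N 0)
    (hχ : χ ∈ weighted p N 0) : pairing φ (ψ - χ) = pairing φ ψ - pairing φ χ := by
  have := inner_sub_right (𝕜 := ℂ) (toState hφ) (toState hψ) (toState hχ)
  simpa only [inner_eq_pairing, lp.coeFn_sub, coe_toState] using this

lemma pairing_add_left {φ ψ χ : Amp N} (hφ : φ ∈ weighted p N 0) (hψ : ψ ∈ weighted p N 0)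
    (hχ : χ ∈ weighted p N 0) : pairing (φ + ψ) χ = pairing φ χ + pairing ψ χ := by
  have := inner_add_left (𝕜 := ℂ) (toState hφ) (toState hψ) (toState hχ)
  simpa only [inner_eq_pairing, lp.coeFn_add, coe_toState] using this

lemma pairing_sub_left {φ ψ χ : Amp N} (hφ : φ ∈ weighted p N 0) (hψ : ψ ∈ weighted p N 0)
    (hχ : χ ∈ weighted p N 0) : pairing (φ - ψ) χ = pairing φ χ - pairing ψ χ := by
  have := inner_sub_left (𝕜 := ℂ) (toState hφ) (toState hψ) (toState hχ)
  simpa only [inner_eq_pairing, lp.coeFn_sub, coe_toState] using this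

lemma pairing_smul_left (c : ℝ) (φ ψ : Amp N) :
    pairing ((c : ℂ) • φ) ψ = c * pairing φ ψ := by
  rw [pairing, pairing, ← tsum_mul_left]
  refine tsum_congr fun i => ?_
  rw [Pi.smul_apply, inner_smul_left, Complex.conj_ofReal]

/-- Reindexing by `addPhoton` turns one series into the other term by term, so adjointness holds for
all amplitudes. -/
lemma pairing_creat (d : Fin 2) (φ ψ : Amp N) :
    pairing φ (creat N d ψ) = pairing (annih N d φ) ψ := by
  rw [pairing, pairing, ← (addPhoton_injective d).tsum_eq]
  · refine tsum_congr fun i => ?_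
    rw [creat_apply_addPhoton, annih_apply, ← smul_eq_mul, ← smul_eq_mul, inner_smul_right,
      inner_smul_left, Complex.conj_ofReal]
  · intro i hi
    by_contra h
    have : i.2 d = 0 := by
      by_contra h'
      exact h (exists_addPhoton_eq d i h')
    exact hi (by simp [creat_apply_of_eq_zero d ψ i this])

lemma pairing_annih (d : Fin 2) (φ ψ : Amp N) :
    pairing φ (annih N d ψ) = pairing (creat N d φ) ψ := by
  rw [← pairing_conj_symm, ← pairing_creat, pairing_conj_symm]

lemma pairing_electronMul (f : (Fin N → Orbital) → ℝ) (φ ψ : Amp N) :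
    pairing φ (electronMul f ψ) = pairing (electronMul f φ) ψ := by
  refine tsum_congr fun i => ?_
  rw [electronMul_apply, electronMul_apply, ← smul_eq_mul, ← smul_eq_mul, inner_smul_right,
    inner_smul_left, Complex.conj_ofReal]

lemma pairing_polCreat (d : Fin 2) {φ ψ : Amp N} (hφ : φ ∈ weighted p N 1)
    (hψ : ψ ∈ weighted p N 1) :
    pairing φ (polCreat p N d ψ) = pairing (polAnnih p N d φ) ψ := by
  have hφ0 := weighted_antitone p N zero_le_one hφ
  have hψ0 := weighted_antitone p N zero_le_one hψ
  have h1 := creat_mem_weighted (k := 0) d hψ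
  have h2 := annih_mem_weighted (k := 0) d hψ
  have h3 := electronMul_mem_weighted (k := 0) (abs_displacement_le p d) hψ
  have h1' := creat_mem_weighted (k := 0) d hφ
  have h2' := annih_mem_weighted (k := 0) d hφ
  have h3' := electronMul_mem_weighted (k := 0) (abs_displacement_le p d) hφ
  rw [polCreat, polAnnih, dressedAnnih_eq]
  simp only [LinearMap.sub_apply, LinearMap.add_apply, LinearMap.smul_apply]
  rw [pairing_sub (p := p) hφ0 (Submodule.add_mem _ (Submodule.smul_mem _ _ h1)
      (Submodule.smul_mem _ _ h2)) h3,
    pairing_add (p := p) hφ0 (Submodule.smul_mem _ _ h1) (Submodule.smul_mem _ _ h2),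
    pairing_sub_left (p := p) (Submodule.add_mem _ (Submodule.smul_mem _ _ h2')
      (Submodule.smul_mem _ _ h1')) h3' hψ0,
    pairing_add_left (p := p) (Submodule.smul_mem _ _ h2') (Submodule.smul_mem _ _ h1') hψ0]
  simp only [pairing_smul, pairing_smul_left, pairing_creat, pairing_annih, pairing_electronMul]

lemma pairing_sum {ι : Type*} (s : Finset ι) {φ : Amp N} {ψ : ι → Amp N}
    (hφ : φ ∈ weighted p N 0) (hψ : ∀ j ∈ s, ψ j ∈ weighted p N 0) :
    pairing φ (∑ j ∈ s, ψ j) = ∑ j ∈ s, pairing φ (ψ j) := by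
  classical
  induction s using Finset.induction_on with
  | empty => simp [pairing]
  | insert j s hj ih =>
    rw [Finset.sum_insert hj, Finset.sum_insert hj, pairing_add (p := p) hφ
      (hψ j (Finset.mem_insert_self _ _))
      (Submodule.sum_mem _ fun k hk => hψ k (Finset.mem_insert_of_mem hk)),
      ih fun k hk => hψ k (Finset.mem_insert_of_mem hk)]

/-- The energy as a sum of squares. -/
lemma pairing_hamiltonian {ψ : Amp N} (hψ : ψ ∈ weighted p N 2) :
    pairing ψ (hamiltonian p N ψ) =
      ((∑' i : Idx N, electronEnergy p i.1 * ‖ψ i‖ ^ 2 + p.hbar * dressedFreq p N *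
        (∑ d, ∑' i, ‖polAnnih p N d ψ i‖ ^ 2 + ∑' i, ‖ψ i‖ ^ 2) : ℝ) : ℂ) := by
  have h0 := weighted_antitone p N zero_le_two hψ
  have h1 := weighted_antitone p N one_le_two hψ
  have hB : ∀ d, polCreat p N d (polAnnih p N d ψ) ∈ weighted p N 0 := fun d =>
    polCreat_mem_weighted d (polAnnih_mem_weighted d hψ)
  have hM := electronMul_mem_weighted (k := 0) (abs_electronEnergy_le p) hψ
  have hS := Submodule.sum_mem (weighted p N 0) (t := Finset.univ) fun d _ => hB d
  have hm : pairing ψ (electronMul (electronEnergy p) ψ) =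
      ((∑' i : Idx N, electronEnergy p i.1 * ‖ψ i‖ ^ 2 : ℝ) : ℂ) := by
    rw [pairing, Complex.ofReal_tsum]
    refine tsum_congr fun i => ?_
    rw [electronMul_apply, ← smul_eq_mul, inner_smul_right, inner_self_eq_norm_sq_to_K]
    push_cast
    rfl
  rw [hamiltonian_apply, pairing_add (p := p) h0 hM
    (Submodule.smul_mem _ _ (Submodule.add_mem _ hS h0)), pairing_smul,
    pairing_add (p := p) h0 hS h0, pairing_sum (p := p) _ h0 fun d _ => hB d, hm, pairing_self]
  have : ∀ d, pairing ψ (polCreat p N d (polAnnih p N d ψ)) =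
      ((∑' i, ‖polAnnih p N d ψ i‖ ^ 2 : ℝ) : ℂ) := fun d => by
    rw [pairing_polCreat d h1 (polAnnih_mem_weighted d hψ), pairing_self]
  simp only [this]
  push_cast
  ring

/-! ### Evolution -/

lemma InDomain.coe_applyOp {ψ : State N} (h : InDomain p N ψ) :
    (applyOp (hamiltonian p N) ψ : Amp N) = hamiltonian p N (ψ : Amp N) :=
  CavityQED.coe_applyOp (hamiltonian_mem_weighted (inDomain_iff.1 h).2)

lemma InDomain.inner_eq {ψ : State N} (h : InDomain p N ψ) :
    inner ℂ ψ (applyOp (hamiltonian p N) ψ) =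
      ((∑' i : Idx N, electronEnergy p i.1 * ‖(ψ : Amp N) i‖ ^ 2 + p.hbar * dressedFreq p N *
        (∑ d, ∑' i, ‖polAnnih p N d (ψ : Amp N) i‖ ^ 2 + ∑' i, ‖(ψ : Amp N) i‖ ^ 2) : ℝ) : ℂ) := by
  rw [inner_eq_pairing, h.coe_applyOp, pairing_hamiltonian (inDomain_iff.1 h).2]

lemma IsSchrodingerSolution.sub {f g : ℝ → State N} (hf : IsSchrodingerSolution p N f)
    (hg : IsSchrodingerSolution p N g) : IsSchrodingerSolution p N (f - g) := by
  intro t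
  have hd : InDomain p N ((f - g) t) := by
    rw [inDomain_iff, Pi.sub_apply, lp.coeFn_sub]
    exact Submodule.sub_mem _ (inDomain_iff.1 (hf t).1) (inDomain_iff.1 (hg t).1)
  refine ⟨hd, ?_⟩
  refine ((hf t).2.sub (hg t).2).congr_deriv ?_
  rw [← smul_sub]
  congr 1
  refine state_ext ?_
  rw [lp.coeFn_sub, hd.coe_applyOp, (hf t).1.coe_applyOp, (hg t).1.coe_applyOp, Pi.sub_apply,
    lp.coeFn_sub, map_sub]

/-- The two contributions to the derivative cancel because the energy expectation is real on the
domain (`InDomain.inner_eq`). -/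
lemma IsSchrodingerSolution.norm_const {f : ℝ → State N} (hf : IsSchrodingerSolution p N f)
    (t : ℝ) : inner ℂ (f t) (f t) = inner ℂ (f 0) (f 0) := by
  have hd : ∀ t, HasDerivAt (fun t => inner ℂ (f t) (f t)) 0 t := by
    intro t
    refine ((hf t).2.inner ℂ (hf t).2).congr_deriv ?_
    rw [inner_smul_right, inner_smul_left, ← inner_conj_symm (applyOp _ _) (f t),
      (hf t).1.inner_eq, Complex.conj_ofReal]
    simp only [map_neg, map_div₀, Complex.conj_I, Complex.conj_ofReal]
    ring
  exact is_const_of_deriv_eq_zero (fun t => (hd t).differentiableAt) (fun t => (hd t).deriv) t 0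

/-- The solution chosen in `evolve` and the given one differ by a solution that starts at zero, and
its norm stays zero. -/
lemma IsSchrodingerSolution.evolve_eq {f : ℝ → State N} (hf : IsSchrodingerSolution p N f)
    (t : ℝ) : evolve p N t (f 0) = f t := by
  have h : ∃ g : ℝ → State N, IsSchrodingerSolution p N g ∧ g 0 = f 0 := ⟨f, hf, rfl⟩
  rw [evolve, dif_pos h]
  obtain ⟨hg, h0⟩ := h.choose_spec
  have := (hg.sub hf).norm_const t
  rw [Pi.sub_apply, Pi.sub_apply, h0, sub_self, inner_zero_left, inner_self_eq_zero] at this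
  exact sub_eq_zero.1 this

/-- Antisymmetric eigenamplitudes of the Hamiltonian in its domain. -/
def IsEigen (p : Params) (E : ℝ) (φ : Amp N) : Prop :=
  φ ∈ fermionic N ⊓ weighted p N 2 ∧ hamiltonian p N φ = (E : ℂ) • φ

/-- The phase acquired by an eigenamplitude of energy `E` during the time `t`. -/
def phase (p : Params) (E t : ℝ) : ℂ := Complex.exp (-(Complex.I / (p.hbar : ℂ)) * E * t)

lemma hasDerivAt_phase (p : Params) (E t : ℝ) :
    HasDerivAt (fun t : ℝ => phase p E t)
      (-(Complex.I / (p.hbar : ℂ)) * (E * phase p E t)) t := by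
  have h := ((hasDerivAt_id t).ofReal_comp.const_mul (-(Complex.I / (p.hbar : ℂ)) * E)).cexp
  refine h.congr_deriv ?_
  simp only [phase, id, Complex.ofReal_one]
  ring

/-- A finite sum of eigenvectors with rotating phases solves the Schrödinger equation in norm, so
uniqueness identifies it with the evolution. -/
lemma coe_evolve {ι : Type*} (s : Finset ι) {E : ι → ℝ} {φ : ι → Amp N}
    (hφ : ∀ j ∈ s, IsEigen p (E j) (φ j)) {ψ : State N} (hψ : (ψ : Amp N) = ∑ j ∈ s, φ j)
    (t : ℝ) : (evolve p N t ψ : Amp N) = ∑ j ∈ s, phase p (E j) t • φ j := by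
  have h0 : ∀ j : s, φ j ∈ weighted p N 0 := fun j =>
    weighted_antitone p N zero_le_two (hφ j j.2).1.2
  let f : ℝ → State N := fun t => ∑ j : s, phase p (E j) t • toState (h0 j)
  have hf : ∀ t, (f t : Amp N) = ∑ j ∈ s, phase p (E j) t • φ j := by
    intro t
    simp only [f, lp.coeFn_sum, lp.coeFn_smul, coe_toState]
    exact Finset.sum_coe_sort s fun j => phase p (E j) t • φ j
  have hs : IsSchrodingerSolution p N f := by
    intro t
    have hd : InDomain p N (f t) := by
      rw [inDomain_iff, hf]
      exact Submodule.sum_mem _ fun j hj => Submodule.smul_mem _ _ (hφ j hj).1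
    refine ⟨hd, ?_⟩
    have := HasDerivAt.fun_sum (u := Finset.univ) fun (j : s) _ =>
      (hasDerivAt_phase p (E j) t).smul_const (toState (h0 j))
    refine this.congr_deriv (Eq.symm ?_)
    refine state_ext ?_
    rw [lp.coeFn_smul, hd.coe_applyOp, hf, map_sum, lp.coeFn_sum, Finset.smul_sum]
    simp only [lp.coeFn_smul, coe_toState]
    rw [Finset.sum_coe_sort s
      fun j => (-(Complex.I / (p.hbar : ℂ)) * (E j * phase p (E j) t)) • φ j]
    refine Finset.sum_congr rfl fun j hj => ?_
    rw [map_smul, (hφ j hj).2]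
    module
  have : f 0 = ψ := by
    refine state_ext ?_
    rw [hf, hψ]
    simp [phase]
  rw [← this, hs.evolve_eq, hf]

/-! ### The vacuum of a displaced dressed mode -/

/-- The amplitudes, in the bare photon number, of the eigenvector of the dressed annihilation
operator with eigenvalue `β`, normalized to `1` at photon number `0`. -/
def modeAmp (p : Params) (N : ℕ) (β : ℝ) : ℕ → ℝ
  | 0 => 1
  | 1 => β / bogMu p N
  | n + 2 => (β * modeAmp p N β (n + 1) - bogNu p N * Real.sqrt (n + 1) * modeAmp p N β n) /
      (bogMu p N * Real.sqrt (n + 2))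

lemma modeAmp_one (p : Params) (N : ℕ) (β : ℝ) :
    bogMu p N * modeAmp p N β 1 = β * modeAmp p N β 0 := by
  have := (bogMu_pos p N).ne'
  simp only [modeAmp]
  field_simp

lemma modeAmp_add_two (p : Params) (N : ℕ) (β : ℝ) (n : ℕ) :
    bogMu p N * Real.sqrt (n + 2) * modeAmp p N β (n + 2)
      + bogNu p N * Real.sqrt (n + 1) * modeAmp p N β n = β * modeAmp p N β (n + 1) := by
  have := (bogMu_pos p N).ne'
  have h : Real.sqrt ((n : ℝ) + 2) ≠ 0 := (Real.sqrt_pos.2 (by positivity)).ne'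
  rw [modeAmp]
  field_simp
  ring

/-- For large `n` the term with `β` is negligible against `√n`, and the recursion contracts over two
steps by nearly `ν/μ < 1`. -/
lemma modeAmp_decay (p : Params) (N : ℕ) (β : ℝ) :
    ∃ C ρ : ℝ, 0 < ρ ∧ ρ < 1 ∧ ∀ n, |modeAmp p N β n| ≤ C * ρ ^ n := by
  have hμ := bogMu_pos p N
  have hν := bogNu_nonneg p N
  set r := bogNu p N / bogMu p N with hr
  have hr0 : 0 ≤ r := by positivity
  have hr1 : r < 1 := (div_lt_one hμ).2 (bogNu_lt_bogMu p N)
  -- `ρ²` is the midpoint of `r` and `1`. The slack `(1 - r)/2` above `r` pays for the term with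
  -- `β`.
  set ρ := Real.sqrt ((1 + r) / 2) with hρ
  have hρ0 : 0 < ρ := Real.sqrt_pos.2 (by linarith)
  have hρ2 : ρ ^ 2 = (1 + r) / 2 := Real.sq_sqrt (by linarith)
  have hρ1 : ρ < 1 := by nlinarith
  -- Threshold: once `√(m + 2) ≥ b`, the coefficient `|β|` is at most `μ √(m + 2) (1 - r)/2`.
  set b := |β| / (bogMu p N * ((1 - r) / 2)) with hb
  have hb0 : 0 ≤ b := div_nonneg (abs_nonneg _) (mul_nonneg hμ.le (by linarith))
  obtain ⟨n₀, hn₀⟩ := exists_nat_ge (b ^ 2)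
  -- The sum dominates each initial ratio. From `n₀ + 2` on, the recursion with `m ≥ n₀` preserves
  -- the bound.
  set C := ∑ k ∈ Finset.range (n₀ + 2), |modeAmp p N β k| / ρ ^ k with hC
  have hC0 : 0 ≤ C := Finset.sum_nonneg fun k _ => by positivity
  refine ⟨C, ρ, hρ0, hρ1, fun n => ?_⟩
  induction n using Nat.strong_induction_on with
  | _ n ih =>
    rcases lt_or_ge n (n₀ + 2) with hn | hn
    · rw [← div_le_iff₀ (by positivity)]
      exact Finset.single_le_sum (f := fun k => |modeAmp p N β k| / ρ ^ k)
        (fun k _ => by positivity) (Finset.mem_range.2 hn)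
    · obtain ⟨m, rfl⟩ : ∃ m, n = m + 2 := ⟨n - 2, by omega⟩
      have h1 := ih (m + 1) (by omega)
      have h0 := ih m (by omega)
      have hm : (n₀ : ℝ) ≤ m := by exact_mod_cast (by omega : n₀ ≤ m)
      set s := Real.sqrt ((m : ℝ) + 2) with hs
      have hs0 : 0 < s := Real.sqrt_pos.2 (by positivity)
      have hbs : b ≤ s := Real.le_sqrt_of_sq_le (by linarith)
      have hss : Real.sqrt ((m : ℝ) + 1) ≤ s := Real.sqrt_le_sqrt (by linarith)
      have hβ : |β| ≤ bogMu p N * s * ((1 - r) / 2) := by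
        rw [hb, div_le_iff₀ (mul_pos hμ (by linarith))] at hbs
        linarith
      have hrec : bogMu p N * s * modeAmp p N β (m + 2) = β * modeAmp p N β (m + 1)
          - bogNu p N * Real.sqrt (m + 1) * modeAmp p N β m := by
        rw [← modeAmp_add_two]; ring
      have hν' : bogNu p N = bogMu p N * r := by rw [hr]; field_simp
      have hpos : 0 < bogMu p N * s := mul_pos hμ hs0
      refine le_of_mul_le_mul_left ?_ hpos
      calc bogMu p N * s * |modeAmp p N β (m + 2)|
          = |β * modeAmp p N β (m + 1) - bogNu p N * Real.sqrt (m + 1) * modeAmp p N β m| := by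
            rw [← hrec, abs_mul, abs_of_pos hpos]
        _ ≤ |β| * |modeAmp p N β (m + 1)|
            + bogNu p N * Real.sqrt (m + 1) * |modeAmp p N β m| := by
            refine (abs_sub _ _).trans (le_of_eq ?_)
            rw [abs_mul, abs_mul, abs_of_nonneg (mul_nonneg hν (Real.sqrt_nonneg _))]
        _ ≤ bogMu p N * s * ((1 - r) / 2) * (C * ρ ^ m) + bogMu p N * r * s * (C * ρ ^ m) := by
            have : C * ρ ^ (m + 1) ≤ C * ρ ^ m :=
              mul_le_mul_of_nonneg_left (pow_le_pow_of_le_one hρ0.le hρ1.le (by omega)) hC0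
            rw [← hν']
            refine add_le_add (mul_le_mul hβ (h1.trans this) (abs_nonneg _)
              (mul_nonneg hpos.le (by linarith))) ?_
            gcongr
        _ = bogMu p N * s * (C * ρ ^ (m + 2)) := by
            rw [pow_add, hρ2]; ring

lemma summable_modeAmp (p : Params) (N : ℕ) (β : ℝ) (k : ℕ) :
    Summable fun n : ℕ => ((n : ℝ) + 1) ^ k * modeAmp p N β n ^ 2 := by
  obtain ⟨C, ρ, h0, h1, h⟩ := modeAmp_decay p N β
  have hs : Summable fun n : ℕ => ((n : ℝ) + 1) ^ k * (ρ ^ 2) ^ (n + 1) := by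
    have := (summable_nat_add_iff 1).2 (summable_pow_mul_geometric_of_norm_lt_one k
      (r := ρ ^ 2) (by rw [Real.norm_of_nonneg (sq_nonneg _)]; nlinarith))
    simpa using this
  refine Summable.of_nonneg_of_le (fun n => by positivity) (fun n => ?_)
    (hs.mul_left (C ^ 2 / ρ ^ 2))
  calc ((n : ℝ) + 1) ^ k * modeAmp p N β n ^ 2 ≤ ((n : ℝ) + 1) ^ k * (C * ρ ^ n) ^ 2 := by
        rw [← sq_abs (modeAmp p N β n)]
        gcongr
        exact h n
    _ = _ := by
        field_simp
        ring

lemma polAnnih_apply (d : Fin 2) (ψ : Amp N) (i : Idx N) :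
    polAnnih p N d ψ i = bogMu p N * (Real.sqrt ((i.2 d : ℝ) + 1) * ψ (addPhoton d i))
      + bogNu p N * creat N d ψ i - displacement p d i.1 * ψ i := by
  rw [polAnnih, dressedAnnih_eq]
  simp [annih_apply]

/-- At fixed electrons, annihilation by `B_d` is a recursion in the photon number whose first
equation already fixes photon number `1`. The value at `0` is the only freedom. -/
lemma apply_eq_modeAmp_mul {ψ : Amp N} {d : Fin 2} (h : polAnnih p N d ψ = 0)
    (x : Fin N → Orbital) (n : Fin 2 → ℕ) (k : ℕ) :
    ψ (x, Function.update n d k) =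
      modeAmp p N (displacement p d x) k * ψ (x, Function.update n d 0) := by
  have hμ : (bogMu p N : ℂ) ≠ 0 := by exact_mod_cast (bogMu_pos p N).ne'
  have hup : ∀ k, addPhoton d (x, Function.update n d k) = (x, Function.update n d (k + 1)) := by
    intro k; simp [addPhoton]
  have hk : ∀ k, polAnnih p N d ψ (x, Function.update n d k) = 0 := fun k => by rw [h]; rfl
  induction k using Nat.strong_induction_on with
  | _ k ih =>
    match k with
    | 0 => simp [modeAmp]
    | 1 =>
      have := hk 0
      rw [polAnnih_apply, hup, creat_apply_of_eq_zero _ _ _ (by simp)] at this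
      simp only [Function.update_self, Nat.cast_zero, zero_add, Real.sqrt_one, Complex.ofReal_one,
        one_mul, mul_zero, add_zero] at this
      refine mul_left_cancel₀ hμ ?_
      have e : (bogMu p N : ℂ) * modeAmp p N (displacement p d x) 1 =
          displacement p d x * modeAmp p N (displacement p d x) 0 := by
        exact_mod_cast modeAmp_one p N (displacement p d x)
      rw [← mul_assoc, e]
      simp only [modeAmp, Complex.ofReal_one, mul_one]
      exact sub_eq_zero.1 this
    | m + 2 =>
      have := hk (m + 1)
      rw [polAnnih_apply, hup, ← hup m, creat_apply_addPhoton, hup, ih (m + 1) (by omega),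
        ih m (by omega)] at this
      have e : (bogMu p N : ℂ) * Real.sqrt (m + 2) * modeAmp p N (displacement p d x) (m + 2)
          + bogNu p N * Real.sqrt (m + 1) * modeAmp p N (displacement p d x) m =
          displacement p d x * modeAmp p N (displacement p d x) (m + 1) := by
        exact_mod_cast modeAmp_add_two p N (displacement p d x) m
      have hs : ((Real.sqrt (m + 2) : ℝ) : ℂ) ≠ 0 := by
        exact_mod_cast (Real.sqrt_pos.2 (by positivity : (0 : ℝ) < m + 2)).ne'
      refine mul_left_cancel₀ (mul_ne_zero hμ hs) ?_
      simp only [Function.update_self, Nat.cast_add, Nat.cast_one] at this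
      have h2 : (m : ℝ) + 1 + 1 = m + 2 := by ring
      rw [h2] at this
      linear_combination this - e * ψ (x, Function.update n d 0)

lemma apply_eq_modeAmp_mul_modeAmp {ψ : Amp N} (h : ∀ d, polAnnih p N d ψ = 0)
    (x : Fin N → Orbital) (n : Fin 2 → ℕ) :
    ψ (x, n) = modeAmp p N (displacement p 0 x) (n 0) *
      modeAmp p N (displacement p 1 x) (n 1) * ψ (x, 0) := by
  have h0 := apply_eq_modeAmp_mul (h 0) x n (n 0)
  have h1 := apply_eq_modeAmp_mul (h 1) x (Function.update n 0 0) (n 1)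
  have e1 : Function.update (Function.update n 0 0) 1 (n 1) = Function.update n 0 0 := by
    rw [Function.update_eq_self_iff]; simp
  have e2 : Function.update (Function.update n 0 0) 1 0 = (0 : Fin 2 → ℕ) := by
    funext j; fin_cases j <;> simp
  rw [Function.update_eq_self] at h0
  rw [e1, e2] at h1
  rw [h0, h1, mul_assoc]

lemma polAnnih_eq_zero_of_forall {ψ : Amp N} {g : (Fin N → Orbital) → ℂ}
    (h : ∀ x n, ψ (x, n) = modeAmp p N (displacement p 0 x) (n 0) *
      modeAmp p N (displacement p 1 x) (n 1) * g x) (d : Fin 2) : polAnnih p N d ψ = 0 := by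
  -- One polarization at a time: `G` collects the electronic factor and the amplitude of the other
  -- mode.
  have key : ∀ (x : Fin N → Orbital) (n : Fin 2 → ℕ) (G : ℂ) (β : ℝ),
      (∀ k, ψ (x, Function.update n d k) = modeAmp p N β k * G) → β = displacement p d x →
      polAnnih p N d ψ (x, n) = 0 := by
    intro x n G β hψ hβ
    have hn := hψ (n d)
    rw [Function.update_eq_self] at hn
    rw [polAnnih_apply, hn, ← hβ]
    simp only [creat, addPhoton, LinearMap.coe_mk, AddHom.coe_mk, hψ]
    rcases hk : n d with _ | k
    · have e : (bogMu p N : ℂ) * modeAmp p N β 1 = β * modeAmp p N β 0 := by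
        exact_mod_cast modeAmp_one p N β
      simp only [Nat.cast_zero, zero_add, Real.sqrt_one, Complex.ofReal_one, Real.sqrt_zero,
        Complex.ofReal_zero]
      linear_combination e * G
    · have e : (bogMu p N : ℂ) * Real.sqrt (k + 2) * modeAmp p N β (k + 2)
          + bogNu p N * Real.sqrt (k + 1) * modeAmp p N β k =
          β * modeAmp p N β (k + 1) := by
        exact_mod_cast modeAmp_add_two p N β k
      have h2 : ((k + 1 : ℕ) : ℝ) + 1 = k + 2 := by push_cast; ring
      have h3 : ((k + 1 : ℕ) : ℝ) = k + 1 := by push_cast; ring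
      rw [h2, h3, Nat.add_sub_cancel]
      linear_combination e * G
  funext ⟨x, n⟩
  fin_cases d
  · refine key x n (modeAmp p N (displacement p 1 x) (n 1) * g x) (displacement p 0 x)
      (fun k => ?_) rfl
    rw [h]; simp [mul_assoc]
  · refine key x n (modeAmp p N (displacement p 0 x) (n 0) * g x) (displacement p 1 x)
      (fun k => ?_) rfl
    rw [h]; simp; ring

/-- The product form lets the sum over the two photon numbers factorize. -/
lemma weight_sq_le (p : Params) (i : Idx N) :
    weight p i ^ 2 ≤ (1 + waveSq p i.1) * ((i.2 0 : ℝ) + 1) * ((i.2 1 : ℝ) + 1) := by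
  rw [weight_sq, Fin.sum_univ_two]
  have h := waveSq_nonneg p i.1
  have h0 : (0 : ℝ) ≤ i.2 0 := Nat.cast_nonneg _
  have h1 : (0 : ℝ) ≤ i.2 1 := Nat.cast_nonneg _
  nlinarith [mul_nonneg h h0, mul_nonneg h h1, mul_nonneg h0 h1, mul_nonneg h (mul_nonneg h0 h1)]

/-- Antisymmetric amplitudes supported on finitely many electronic configurations of energy `ε`,
with the displaced dressed modes in their vacuum. -/
structure IsDressedVacuum (p : Params) (ε : ℝ) (ψ : Amp N) : Prop where
  fermionic : ψ ∈ fermionic N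
  finite : {x | ∃ n, ψ (x, n) ≠ 0}.Finite
  energy : ∀ x n, ψ (x, n) ≠ 0 → electronEnergy p x = ε
  annih : ∀ d, polAnnih p N d ψ = 0

namespace IsDressedVacuum

variable {ε : ℝ} {ψ : Amp N}

/-- In each of finitely many configurations the amplitude is a product of two geometrically decaying
sequences, which beats every power of the weight. -/
lemma mem_weighted (h : IsDressedVacuum p ε ψ) (k : ℕ) : ψ ∈ weighted p N k := by
  rw [CavityQED.mem_weighted, summable_prod_of_nonneg fun i => sq_nonneg _]
  constructor
  · intro x
    have hs := (summable_modeAmp p N (displacement p 0 x) k).mul_of_nonneg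
      (summable_modeAmp p N (displacement p 1 x) k) (fun n => by positivity)
      (fun n => by positivity)
    rw [← (finTwoArrowEquiv ℕ).summable_iff] at hs
    refine Summable.of_nonneg_of_le (fun n => sq_nonneg _) (fun n => ?_)
      (hs.mul_left ((1 + waveSq p x) ^ k * ‖ψ (x, 0)‖ ^ 2))
    have hw := waveSq_nonneg p x
    rw [apply_eq_modeAmp_mul_modeAmp h.annih, mul_pow, ← pow_mul, mul_comm k 2, pow_mul]
    calc _ ≤ ((1 + waveSq p x) * ((n 0 : ℝ) + 1) * ((n 1 : ℝ) + 1)) ^ k * _ := by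
          gcongr
          exact weight_sq_le p (x, n)
      _ = _ := by
          simp only [norm_mul, Complex.norm_real, Real.norm_eq_abs, mul_pow, sq_abs,
            Function.comp_apply]
          rw [show (finTwoArrowEquiv ℕ n).1 = n 0 from rfl,
            show (finTwoArrowEquiv ℕ n).2 = n 1 from rfl]
          ring
  · refine summable_of_hasFiniteSupport (h.finite.subset fun x hx => ?_)
    by_contra hc
    simp only [Set.mem_ofPred_eq, not_exists, not_not] at hc
    exact hx (by simp [hc])

/-- Symmetric functions of the electrons commute with the modes and do not enlarge the support, so
applying `v` gives a vacuum of the same energy. -/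
lemma electronMul (h : IsDressedVacuum p ε ψ) {f : (Fin N → Orbital) → ℝ}
    (hf : ∀ x (π : Equiv.Perm (Fin N)), f (x ∘ π) = f x) :
    IsDressedVacuum p ε (electronMul f ψ) where
  fermionic := electronMul_mem_fermionic hf h.fermionic
  finite := h.finite.subset fun x ⟨n, hn⟩ => ⟨n, right_ne_zero_of_mul hn⟩
  energy x n hn := h.energy x n (right_ne_zero_of_mul hn)
  annih d := by
    have := LinearMap.congr_fun (electronMul_comm_polAnnih (p := p) f d).eq ψ
    rw [Module.End.mul_apply, Module.End.mul_apply, h.annih, map_zero] at this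
    exact this.symm

lemma smul (h : IsDressedVacuum p ε ψ) (c : ℂ) : IsDressedVacuum p ε (c • ψ) where
  fermionic := Submodule.smul_mem _ _ h.fermionic
  finite := h.finite.subset fun x ⟨n, hn⟩ => ⟨n, right_ne_zero_of_mul hn⟩
  energy x n hn := h.energy x n (right_ne_zero_of_mul hn)
  annih d := by rw [map_smul, h.annih, smul_zero]

lemma electronMul_energy (h : IsDressedVacuum p ε ψ) :
    CavityQED.electronMul (electronEnergy p) ψ = (ε : ℂ) • ψ := by
  funext ⟨x, n⟩
  by_cases h0 : ψ (x, n) = 0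
  · simp [h0]
  · simp [h.energy x n h0]

lemma creat_mem_weighted (h : IsDressedVacuum p ε ψ) (d : Fin 2) (k : ℕ) :
    polCreat p N d ψ ∈ weighted p N k :=
  polCreat_mem_weighted d (h.mem_weighted (k + 1))

lemma annih_creat (h : IsDressedVacuum p ε ψ) (d : Fin 2) :
    polAnnih p N d (polCreat p N d ψ) = ψ := by
  have := LinearMap.congr_fun (polAnnih_mul_polCreat (p := p) (N := N) d) ψ
  simpa [h.annih] using this

lemma annih_creat_creat (h : IsDressedVacuum p ε ψ) (d : Fin 2) :
    polAnnih p N d (polCreat p N d (polCreat p N d ψ)) = (2 : ℂ) • polCreat p N d ψ := by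
  have := LinearMap.congr_fun (polAnnih_mul_polCreat (p := p) (N := N) d) (polCreat p N d ψ)
  simp only [Module.End.mul_apply, LinearMap.add_apply, Module.End.one_apply,
    h.annih_creat] at this
  rw [this, two_smul]

lemma annih_creat_of_ne (h : IsDressedVacuum p ε ψ) {d d' : Fin 2} (hd : d' ≠ d) :
    polAnnih p N d' (polCreat p N d ψ) = 0 := by
  have := LinearMap.congr_fun (polAnnih_comm_polCreat (p := p) (N := N) hd).eq ψ
  simpa [h.annih] using this

lemma annih_creat_creat_of_ne (h : IsDressedVacuum p ε ψ) {d d' : Fin 2} (hd : d' ≠ d) :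
    polAnnih p N d' (polCreat p N d (polCreat p N d ψ)) = 0 := by
  have := LinearMap.congr_fun (polAnnih_comm_polCreat (p := p) (N := N) hd).eq (polCreat p N d ψ)
  simpa [h.annih_creat_of_ne hd] using this

/-- The zero-point energies `ħω̃/2` of the two polarizations add up to `ħω̃`. -/
lemma isEigen (h : IsDressedVacuum p ε ψ) :
    IsEigen p (ε + p.hbar * dressedFreq p N) ψ := by
  refine ⟨⟨h.fermionic, h.mem_weighted 2⟩, ?_⟩
  rw [hamiltonian_apply, h.electronMul_energy]
  simp only [h.annih, map_zero, Finset.sum_const_zero]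
  push_cast
  module

lemma isEigen_creat (h : IsDressedVacuum p ε ψ) (d : Fin 2) :
    IsEigen p (ε + 2 * (p.hbar * dressedFreq p N)) (polCreat p N d ψ) := by
  refine ⟨⟨polCreat_mem_fermionic d h.fermionic, h.creat_mem_weighted d 2⟩, ?_⟩
  have he := LinearMap.congr_fun
    (electronMul_comm_polCreat (p := p) (electronEnergy (N := N) p) d).eq ψ
  simp only [Module.End.mul_apply, h.electronMul_energy, map_smul] at he
  rw [hamiltonian_apply, he, Finset.sum_eq_single d, h.annih_creat]
  · push_cast
    module
  · intro d' _ hd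
    rw [h.annih_creat_of_ne hd, map_zero]
  · simp

lemma isEigen_creat_creat (h : IsDressedVacuum p ε ψ) (d : Fin 2) :
    IsEigen p (ε + 3 * (p.hbar * dressedFreq p N)) (polCreat p N d (polCreat p N d ψ)) := by
  refine ⟨⟨polCreat_mem_fermionic d (polCreat_mem_fermionic d h.fermionic),
    polCreat_mem_weighted d (h.creat_mem_weighted d 3)⟩, ?_⟩
  have hc := (electronMul_comm_polCreat (p := p) (electronEnergy (N := N) p) d)
  have he := LinearMap.congr_fun (hc.mul_right hc).eq ψ
  simp only [Module.End.mul_apply, h.electronMul_energy, map_smul] at he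
  rw [hamiltonian_apply, he, Finset.sum_eq_single d, h.annih_creat_creat, map_smul]
  · push_cast
    module
  · intro d' _ hd
    rw [h.annih_creat_creat_of_ne hd, map_zero]
  · simp

end IsDressedVacuum

/-! ### Slater determinants -/

lemma slater_comp {κ : Fin N → Orbital} (x : Fin N → Orbital) (π : Equiv.Perm (Fin N)) :
    slater κ (x ∘ π) = ((Equiv.Perm.sign π : ℤ) : ℂ) * slater κ x := by
  have := Matrix.det_permute' π (Matrix.of fun i j : Fin N => if κ i = x j then (1 : ℂ) else 0)
  rw [slater, slater, mul_left_comm, ← this]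
  rfl

lemma slater_self {κ : Fin N → Orbital} (hκ : Function.Injective κ) : slater κ κ ≠ 0 := by
  have : (Matrix.of fun i j : Fin N => if κ i = κ j then (1 : ℂ) else 0) = 1 := by
    ext i j
    simp [Matrix.one_apply, hκ.eq_iff]
  rw [slater, this, Matrix.det_one, mul_one]
  have : Real.sqrt (N.factorial : ℝ) ≠ 0 :=
    (Real.sqrt_pos.2 (by exact_mod_cast N.factorial_pos)).ne'
  exact one_div_ne_zero (by exact_mod_cast this)

/-- Some term of the Leibniz expansion is nonzero, so its permutation matches `κ` with `x`. -/
lemma exists_perm_of_slater_ne_zero {κ x : Fin N → Orbital} (h : slater κ x ≠ 0) :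
    ∃ π : Equiv.Perm (Fin N), κ ∘ π = x := by
  have hd := right_ne_zero_of_mul h
  rw [Matrix.det_apply] at hd
  obtain ⟨π, -, hπ⟩ := Finset.exists_ne_zero_of_sum_ne_zero hd
  refine ⟨π, funext fun j => ?_⟩
  by_contra hj
  refine hπ ?_
  rw [Finset.prod_eq_zero (Finset.mem_univ j), smul_zero]
  simpa using hj

lemma finite_slater_support (κ : Fin N → Orbital) : {x | slater κ x ≠ 0}.Finite :=
  (Set.finite_range fun π : Equiv.Perm (Fin N) => κ ∘ π).subset fun _ hx =>
    exists_perm_of_slater_ne_zero hx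

/-- The photon factor may depend symmetrically on the electrons. This covers both the displaced
vacuum built below and the Fermi sea, whose photon factor is independent of them. -/
lemma isDressedVacuum_of_slater {ψ : Amp N} {κ : Fin N → Orbital} {φ : Idx N → ℂ}
    (hφ : ∀ x (π : Equiv.Perm (Fin N)) n, φ (x ∘ π, n) = φ (x, n))
    (hψ : ∀ x n, ψ (x, n) = slater κ x * φ (x, n)) (ha : ∀ d, polAnnih p N d ψ = 0) :
    IsDressedVacuum p (electronEnergy p κ) ψ where
  fermionic π x n := by rw [hψ, hψ, slater_comp, hφ, mul_assoc]
  finite := (finite_slater_support κ).subset fun x ⟨n, hn⟩ => by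
    rw [hψ] at hn
    exact left_ne_zero_of_mul hn
  energy x n hn := by
    rw [hψ] at hn
    obtain ⟨π, rfl⟩ := exists_perm_of_slater_ne_zero (left_ne_zero_of_mul hn)
    exact electronEnergy_comp κ π
  annih := ha

lemma exists_isDressedVacuum (p : Params) {κ : Fin N → Orbital} (hκ : Function.Injective κ) :
    ∃ ψ : State N, IsDressedVacuum p (electronEnergy p κ) (ψ : Amp N) ∧ ‖ψ‖ = 1 := by
  let φ : Idx N → ℂ := fun i => modeAmp p N (displacement p 0 i.1) (i.2 0) *
      modeAmp p N (displacement p 1 i.1) (i.2 1)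
  let ψ : Amp N := fun i => slater κ i.1 * φ i
  have hv : IsDressedVacuum p (electronEnergy p κ) ψ :=
    isDressedVacuum_of_slater (φ := φ) (fun x π n => by simp only [φ, displacement_comp])
      (fun x n => rfl)
      (polAnnih_eq_zero_of_forall (g := slater κ) fun x n => mul_comm _ _)
  have hne : toState (hv.mem_weighted 0) ≠ 0 := by
    intro h0
    have : (toState (hv.mem_weighted 0) : Amp N) (κ, 0) = 0 := by rw [h0]; rfl
    rw [coe_toState] at this
    simp [ψ, φ, modeAmp, slater_self hκ] at this
  refine ⟨((‖toState (hv.mem_weighted 0)‖⁻¹ : ℝ) : ℂ) • toState (hv.mem_weighted 0), ?_, ?_⟩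
  · rw [lp.coeFn_smul, coe_toState]
    exact hv.smul _
  · rw [norm_smul, Complex.norm_real, norm_inv, norm_norm,
      inv_mul_cancel₀ (norm_ne_zero_iff.2 hne)]

/-! ### Ground states -/

/-- By `le_electronEnergy` an energy bound confines every integer wave-vector component to a bounded
interval. -/
lemma finite_setOf_electronEnergy_le (p : Params) (N : ℕ) (c : ℝ) :
    {x : Fin N → Orbital | electronEnergy p x ≤ c}.Finite := by
  have hh := p.hbar_pos
  have hm := p.mass_pos
  have hs := p.side_pos
  have hπ := Real.pi_pos
  have hγ : 0 < 1 - coupling p N := by linarith [coupling_lt_one p N]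
  set a := (1 - coupling p N) * (p.hbar ^ 2 / (2 * p.mass) * (2 * Real.pi / p.side) ^ 2) with ha
  have ha0 : 0 < a := by positivity
  obtain ⟨M, hM⟩ := exists_nat_ge (c / a)
  have hfin : {o : Orbital | ∀ d, o.1 d ∈ Set.Icc (-(M : ℤ)) M}.Finite := by
    refine ((Set.Finite.pi' fun _ : Fin 2 => Set.finite_Icc (-(M : ℤ)) M).prod
      (Set.finite_univ (α := Bool))).subset fun o ho => ⟨ho, Set.mem_univ _⟩
  refine (Set.Finite.pi' fun _ : Fin N => hfin).subset fun x hx j d => ?_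
  have h1 : waveVector p (x j) d ^ 2 ≤ waveSq p x :=
    (Finset.single_le_sum (f := fun d => waveVector p (x j) d ^ 2) (fun _ _ => sq_nonneg _)
      (Finset.mem_univ d)).trans
    (Finset.single_le_sum (f := fun j => ∑ d, waveVector p (x j) d ^ 2)
      (fun _ _ => Finset.sum_nonneg fun _ _ => sq_nonneg _) (Finset.mem_univ j))
  have h2 : a * ((x j).1 d : ℝ) ^ 2 ≤ c := by
    refine le_trans ?_ ((le_electronEnergy p x).trans hx)
    calc a * ((x j).1 d : ℝ) ^ 2 =
        (1 - coupling p N) * (p.hbar ^ 2 / (2 * p.mass) * waveVector p (x j) d ^ 2) := by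
          rw [ha, waveVector]; ring
      _ ≤ _ := by gcongr
  have h3 : ((x j).1 d : ℝ) ^ 2 ≤ M := by
    refine le_trans ?_ hM
    rw [le_div_iff₀ ha0]
    linarith
  have h4 : (x j).1 d ^ 2 ≤ (M : ℤ) := by exact_mod_cast h3
  -- For an integer, `|n| ≤ n² ≤ M`.
  exact ⟨by nlinarith, by nlinarith⟩

lemma exists_min_electronEnergy (p : Params) (N : ℕ) :
    ∃ κ : Fin N → Orbital, Function.Injective κ ∧
      ∀ x : Fin N → Orbital, Function.Injective x → electronEnergy p κ ≤ electronEnergy p x := by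
  -- Any injective configuration would do; it makes the finite sublevel set nonempty.
  let x₀ : Fin N → Orbital := fun j => (fun _ => (j : ℤ), false)
  have hx₀ : Function.Injective x₀ := by
    intro i j h
    have := congrFun (congrArg Prod.fst h) 0
    simpa [x₀, Fin.ext_iff] using this
  obtain ⟨κ, ⟨hκ, hκ'⟩, hmin⟩ := Set.exists_min_image
    ({x : Fin N → Orbital | electronEnergy p x ≤ electronEnergy p x₀} ∩
      {x | Function.Injective x}) (electronEnergy p)
    ((finite_setOf_electronEnergy_le p N _).inter_of_left _)
    ⟨x₀, le_refl (electronEnergy p x₀), hx₀⟩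
  refine ⟨κ, hκ', fun x hx => ?_⟩
  rcases le_total (electronEnergy p x) (electronEnergy p x₀) with h | h
  · exact hmin x ⟨h, hx⟩
  · exact le_trans hκ h

lemma IsDressedVacuum.inDomain {ε : ℝ} {ψ : State N} (h : IsDressedVacuum p ε (ψ : Amp N)) :
    InDomain p N ψ :=
  inDomain_iff.2 h.isEigen.1

lemma IsDressedVacuum.inner_eq {ε : ℝ} {ψ : State N} (h : IsDressedVacuum p ε (ψ : Amp N))
    (h1 : ‖ψ‖ = 1) : (inner ℂ ψ (applyOp (hamiltonian p N) ψ)).re =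
      ε + p.hbar * dressedFreq p N := by
  rw [inner_eq_pairing, h.inDomain.coe_applyOp, h.isEigen.2, pairing_smul, ← inner_eq_pairing,
    inner_self_eq_norm_sq_to_K, h1]
  simp

lemma summable_norm_sq {φ : Amp N} (h : φ ∈ weighted p N 0) : Summable fun i => ‖φ i‖ ^ 2 :=
  memℓp_two_iff.1 (mem_weighted_zero.1 h)

lemma summable_electronEnergy {ψ : Amp N} (h : ψ ∈ weighted p N 1) :
    Summable fun i => electronEnergy p i.1 * ‖ψ i‖ ^ 2 := by
  have hs := mem_weighted.1 h
  refine Summable.of_nonneg_of_le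
    (fun i => mul_nonneg (electronEnergy_nonneg p i.1) (sq_nonneg _)) (fun i => ?_)
    (hs.mul_left (p.hbar ^ 2 / (2 * p.mass)))
  rw [pow_one, mul_pow, ← mul_assoc]
  exact mul_le_mul_of_nonneg_right ((le_abs_self _).trans (abs_electronEnergy_le p i))
    (sq_nonneg _)

/-- The energy above the ground state energy, as a sum of squares. -/
lemma InDomain.energy_eq {ψ : State N} (h : InDomain p N ψ) (h1 : ‖ψ‖ = 1) (ε : ℝ) :
    (inner ℂ ψ (applyOp (hamiltonian p N) ψ)).re = ε + p.hbar * dressedFreq p N +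
      (∑' i : Idx N, (electronEnergy p i.1 - ε) * ‖(ψ : Amp N) i‖ ^ 2 +
        p.hbar * dressedFreq p N * ∑ d, ∑' i, ‖polAnnih p N d (ψ : Amp N) i‖ ^ 2) := by
  have hw := (inDomain_iff.1 h).2
  have h1' : ∑' i, ‖(ψ : Amp N) i‖ ^ 2 = 1 := by rw [← norm_sq_eq, h1, one_pow]
  have hs := summable_norm_sq (coe_mem_weighted p ψ)
  have he := summable_electronEnergy (weighted_antitone p N one_le_two hw)
  have : ∑' i : Idx N, (electronEnergy p i.1 - ε) * ‖(ψ : Amp N) i‖ ^ 2 =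
      ∑' i : Idx N, electronEnergy p i.1 * ‖(ψ : Amp N) i‖ ^ 2 - ε := by
    simp only [sub_mul]
    rw [he.tsum_sub (hs.mul_left ε), tsum_mul_left, h1', mul_one]
  rw [h.inner_eq, Complex.ofReal_re, this, h1']
  ring

/-- The coefficient can be negative only at configurations with a repeated orbital, where the
amplitude vanishes. -/
lemma energy_term_nonneg {ψ : Amp N} (h : IsFermionic ψ) {ε : ℝ}
    (hε : ∀ x : Fin N → Orbital, Function.Injective x → ε ≤ electronEnergy p x) (i : Idx N) :
    0 ≤ (electronEnergy p i.1 - ε) * ‖ψ i‖ ^ 2 := by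
  by_cases hi : Function.Injective i.1
  · exact mul_nonneg (sub_nonneg.2 (hε _ hi)) (sq_nonneg _)
  · have : ψ i = 0 := h.apply_eq_zero hi i.2
    simp [this]

lemma InDomain.le_energy {ψ : State N} (h : InDomain p N ψ) (h1 : ‖ψ‖ = 1) {ε : ℝ}
    (hε : ∀ x : Fin N → Orbital, Function.Injective x → ε ≤ electronEnergy p x) :
    ε + p.hbar * dressedFreq p N ≤ (inner ℂ ψ (applyOp (hamiltonian p N) ψ)).re := by
  rw [h.energy_eq h1 ε]
  refine le_add_of_nonneg_right (add_nonneg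
    (tsum_nonneg (energy_term_nonneg (inDomain_iff.1 h).1 hε)) (mul_nonneg
    (mul_pos p.hbar_pos (dressedFreq_pos p N)).le
    (Finset.sum_nonneg fun d _ => tsum_nonneg fun i => sq_nonneg _)))

lemma exists_isGroundState (p : Params) (N : ℕ) : ∃ Ψ : State N, IsGroundState p N Ψ := by
  obtain ⟨κ, hκ, hmin⟩ := exists_min_electronEnergy p N
  obtain ⟨Ψ, hΨ, h1⟩ := exists_isDressedVacuum p hκ
  refine ⟨Ψ, hΨ.inDomain, h1, fun Φ hΦ hΦ1 => ?_⟩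
  rw [hΨ.inner_eq h1]
  exact hΦ.le_energy hΦ1 hmin

/-- Comparison with an explicit vacuum over a minimizing configuration forces both nonnegative sums
in `InDomain.energy_eq` to vanish, hence every term of them. The ground state may be degenerate, but
its support lies in the finite set of minimizing configurations. -/
lemma IsGroundState.isDressedVacuum {Ψ : State N} (h : IsGroundState p N Ψ) :
    ∃ ε, IsDressedVacuum p ε (Ψ : Amp N) := by
  obtain ⟨κ, hκ, hmin⟩ := exists_min_electronEnergy p N
  obtain ⟨Φ, hΦ, hΦ1⟩ := exists_isDressedVacuum p hκ
  obtain ⟨hd, h1, hle⟩ := h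
  have hle := hle Φ hΦ.inDomain hΦ1
  rw [hΦ.inner_eq hΦ1, hd.energy_eq h1 (electronEnergy p κ)] at hle
  obtain ⟨hf, hw⟩ := inDomain_iff.1 hd
  have hpos := mul_pos p.hbar_pos (dressedFreq_pos p N)
  have hnn := energy_term_nonneg hf hmin
  have hA : 0 ≤ ∑' i : Idx N,
      (electronEnergy p i.1 - electronEnergy p κ) * ‖(Ψ : Amp N) i‖ ^ 2 := tsum_nonneg hnn
  have hB : ∀ d ∈ Finset.univ, 0 ≤ ∑' i, ‖polAnnih p N d (Ψ : Amp N) i‖ ^ 2 :=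
    fun d _ => tsum_nonneg fun i => sq_nonneg _
  have hB' := mul_nonneg hpos.le (Finset.sum_nonneg hB)
  have hA0 : ∑' i : Idx N, (electronEnergy p i.1 - electronEnergy p κ) * ‖(Ψ : Amp N) i‖ ^ 2 = 0 :=
    le_antisymm (by linarith) hA
  have hB0 : ∑ d, ∑' i, ‖polAnnih p N d (Ψ : Amp N) i‖ ^ 2 = 0 := by
    have : p.hbar * dressedFreq p N * ∑ d, ∑' i, ‖polAnnih p N d (Ψ : Amp N) i‖ ^ 2 = 0 :=
      le_antisymm (by linarith) hB'
    exact (mul_eq_zero.1 this).resolve_left hpos.ne'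
  rw [Finset.sum_eq_zero_iff_of_nonneg hB] at hB0
  have hs : Summable fun i : Idx N =>
      (electronEnergy p i.1 - electronEnergy p κ) * ‖(Ψ : Amp N) i‖ ^ 2 := by
    simp only [sub_mul]
    exact (summable_electronEnergy (weighted_antitone p N one_le_two hw)).sub
      ((summable_norm_sq (coe_mem_weighted p Ψ)).mul_left _)
  have he : ∀ x n, (Ψ : Amp N) (x, n) ≠ 0 → electronEnergy p x = electronEnergy p κ := by
    intro x n hx
    have h0 := congrFun ((hasSum_zero_iff_of_nonneg hnn).1 (hA0 ▸ hs.hasSum)) (x, n)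
    have := (mul_eq_zero.1 h0).resolve_right (pow_ne_zero 2 (norm_ne_zero_iff.2 hx))
    linarith
  refine ⟨electronEnergy p κ, hf, ?_, he, fun d => ?_⟩
  · exact (finite_setOf_electronEnergy_le p N (electronEnergy p κ)).subset
      fun x ⟨n, hn⟩ => (he x n hn).le
  · have hsd : Summable fun i => ‖polAnnih p N d (Ψ : Amp N) i‖ ^ 2 :=
      summable_norm_sq (weighted_antitone p N zero_le_one (polAnnih_mem_weighted d hw))
    have := (hasSum_zero_iff_of_nonneg fun i => sq_nonneg _).1
      (hB0 d (Finset.mem_univ d) ▸ hsd.hasSum)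
    funext i
    simpa using congrFun this i

/-! ### The Fermi sea -/

/-- The filled disk is symmetric under `k ↦ -k`. This reflection permutes the occupied orbitals, so
the total wave vector equals its own negative. -/
lemma totalWave_eq_zero {κ : Fin N → Orbital} {kF : ℝ} (hκ : Function.Injective κ)
    (hr : Set.range κ = {o | waveVector p o 0 ^ 2 + waveVector p o 1 ^ 2 ≤ kF ^ 2})
    (d : Fin 2) : totalWave p κ d = 0 := by
  have hw : ∀ (o : Orbital) d, waveVector p (-o.1, o.2) d = -waveVector p o d := by
    intro o d
    simp only [waveVector, Pi.neg_apply, Int.cast_neg]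
    ring
  have hex : ∀ j, ∃ k, κ k = (-(κ j).1, (κ j).2) := by
    intro j
    have hj : κ j ∈ Set.range κ := ⟨j, rfl⟩
    rw [hr] at hj
    have : ((-(κ j).1, (κ j).2) : Orbital) ∈ Set.range κ := by
      rw [hr]
      simpa only [Set.mem_ofPred_eq, hw, neg_sq] using hj
    exact this
  choose σ hσ using hex
  have hinj : Function.Injective σ := by
    intro i j hij
    have := (hσ i).symm.trans ((congrArg κ hij).trans (hσ j))
    simp only [Prod.mk.injEq, neg_inj] at this
    exact hκ (Prod.ext this.1 this.2)
  have := (Finite.injective_iff_bijective.1 hinj).sum_comp fun j => waveVector p (κ j) d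
  simp only [hσ, hw, Finset.sum_neg_distrib] at this
  rw [totalWave]
  linarith

lemma IsFermiSeaState.totalWave_eq_zero {Ψ : State N} (h : IsFermiSeaState p N Ψ)
    {x : Fin N → Orbital} {n : Fin 2 → ℕ} (hx : (Ψ : Amp N) (x, n) ≠ 0) (d : Fin 2) :
    totalWave p x d = 0 := by
  obtain ⟨-, ⟨kF, κ, φ, -, hκ, hr, hΨ⟩, -⟩ := h
  rw [hΨ] at hx
  obtain ⟨π, rfl⟩ := exists_perm_of_slater_ne_zero (left_ne_zero_of_mul hx)
  rw [totalWave_comp, CavityQED.totalWave_eq_zero hκ hr]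

/-- Without total momentum the displacement vanishes on the support, and the undisplaced vacuum is
the displaced one. -/
lemma IsFermiSeaState.isDressedVacuum {Ψ : State N} (h : IsFermiSeaState p N Ψ) :
    ∃ ε, IsDressedVacuum p ε (Ψ : Amp N) := by
  have h' := h
  obtain ⟨-, ⟨kF, κ, φ, -, hκ, hr, hΨ⟩, ha⟩ := h'
  refine ⟨_, isDressedVacuum_of_slater (κ := κ) (φ := fun i => φ i.2) (fun _ _ _ => rfl) hΨ
    fun d => ?_⟩
  rw [polAnnih, LinearMap.sub_apply, ha d, zero_sub, neg_eq_zero]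
  funext ⟨x, n⟩
  by_cases h0 : (Ψ : Amp N) (x, n) = 0
  · simp [h0]
  · simp [displacement, h.totalWave_eq_zero h0]

/-! ### Response functions -/

lemma isEigen_zero (p : Params) (N : ℕ) (E : ℝ) : IsEigen p E (0 : Amp N) :=
  ⟨Submodule.zero_mem _, by simp⟩

lemma IsEigen.smul {E : ℝ} {φ : Amp N} (h : IsEigen p E φ) (c : ℂ) : IsEigen p E (c • φ) :=
  ⟨Submodule.smul_mem _ _ h.1, by rw [map_smul, h.2, smul_comm]⟩

lemma IsEigen.add {E : ℝ} {φ ψ : Amp N} (h : IsEigen p E φ) (h' : IsEigen p E ψ) :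
    IsEigen p E (φ + ψ) :=
  ⟨Submodule.add_mem _ h.1 h'.1, by rw [map_add, h.2, h'.2, smul_add]⟩

lemma coe_evolve_three {E₀ E₁ E₂ : ℝ} {φ₀ φ₁ φ₂ : Amp N} (h₀ : IsEigen p E₀ φ₀)
    (h₁ : IsEigen p E₁ φ₁) (h₂ : IsEigen p E₂ φ₂) {ψ : State N}
    (hψ : (ψ : Amp N) = φ₀ + φ₁ + φ₂) (t : ℝ) :
    (evolve p N t ψ : Amp N) = phase p E₀ t • φ₀ + phase p E₁ t • φ₁ + phase p E₂ t • φ₂ := by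
  have := coe_evolve (p := p) (Finset.univ : Finset (Fin 3)) (E := ![E₀, E₁, E₂])
    (φ := ![φ₀, φ₁, φ₂]) (fun j _ => by fin_cases j <;> assumption) (ψ := ψ)
    (by rw [hψ, Fin.sum_univ_three]; rfl) t
  rw [this, Fin.sum_univ_three]
  rfl

lemma phase_mul_phase_neg (p : Params) (E t : ℝ) : phase p E (-t) * phase p E t = 1 := by
  rw [phase, phase, ← Complex.exp_add, Complex.ofReal_neg]
  simp

lemma phase_add (p : Params) (E E' t : ℝ) : phase p (E + E') t = phase p E t * phase p E' t := by
  rw [phase, phase, phase, ← Complex.exp_add, Complex.ofReal_add]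
  congr 1
  ring

/-- Operators that are linear in the displaced dressed mode `d`. -/
def linearOp (p : Params) (d : Fin 2) (v : (Fin N → Orbital) → ℝ) (g : ℝ) :
    Module.End ℂ (Amp N) :=
  electronMul v + (g : ℂ) • (polAnnih p N d + polCreat p N d)

lemma vecPot_eq_linearOp (p : Params) (N : ℕ) (d : Fin 2) :
    vecPot p N d =
      linearOp p d (fun x => 2 * dressedAmp p N * displacement p d x) (dressedAmp p N) := by
  rw [vecPot_eq, linearOp]
  refine LinearMap.ext fun ψ => funext fun i => ?_
  simp only [LinearMap.smul_apply, LinearMap.add_apply, Pi.smul_apply, Pi.add_apply,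
    electronMul_apply, smul_eq_mul]
  push_cast
  ring

/-- The paramagnetic current enters only the electronic part. The mode coefficient is that of `A_d`
times `-e²N/m`. -/
lemma current_eq_linearOp (p : Params) (N : ℕ) (d : Fin 2) :
    current p N d =
      linearOp p d (fun x => p.charge * p.hbar / p.mass * totalWave p x d
        - p.charge ^ 2 * N / p.mass * (2 * dressedAmp p N * displacement p d x))
        (-(p.charge ^ 2 * N / p.mass * dressedAmp p N)) := by
  rw [current, currentPara_eq, currentDia, vecPot_eq_linearOp, linearOp, linearOp]
  refine LinearMap.ext fun ψ => funext fun i => ?_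
  simp only [LinearMap.smul_apply, LinearMap.add_apply, Pi.smul_apply, Pi.add_apply,
    electronMul_apply, smul_eq_mul]
  push_cast
  ring

namespace IsDressedVacuum

variable {ε : ℝ}

lemma pairing_creat {ψ φ : Amp N} (h : IsDressedVacuum p ε ψ) (d : Fin 2)
    (hφ : φ ∈ weighted p N 1) : pairing ψ (polCreat p N d φ) = 0 := by
  rw [pairing_polCreat d (h.mem_weighted 1) hφ, h.annih]
  simp [pairing]

lemma linearOp_apply {ψ : Amp N} (h : IsDressedVacuum p ε ψ) (d : Fin 2)
    (v : (Fin N → Orbital) → ℝ) (g : ℝ) :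
    linearOp p d v g ψ = CavityQED.electronMul v ψ + (g : ℂ) • polCreat p N d ψ := by
  simp [linearOp, h.annih]

lemma linearOp_creat {ψ : Amp N} (h : IsDressedVacuum p ε ψ) (d : Fin 2)
    (v : (Fin N → Orbital) → ℝ) (g : ℝ) :
    linearOp p d v g (polCreat p N d ψ) = polCreat p N d (CavityQED.electronMul v ψ)
      + (g : ℂ) • (ψ + polCreat p N d (polCreat p N d ψ)) := by
  have := LinearMap.congr_fun (electronMul_comm_polCreat (p := p) v d).eq ψ
  simp only [Module.End.mul_apply] at this
  simp [linearOp, h.annih_creat, this]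

variable {Ψ : State N} {v : (Fin N → Orbital) → ℝ}

/-- Applying `v` leaves the energy unchanged, so its phases cancel. The one-quantum component has
gained `ħω̃` and keeps the phase `e^{iω̃t}`. -/
lemma coe_interaction (h : IsDressedVacuum p ε (Ψ : Amp N)) (d : Fin 2)
    (hv : ∀ x (π : Equiv.Perm (Fin N)), v (x ∘ π) = v x) (g t : ℝ) :
    (interaction p (linearOp p d v g) t Ψ : Amp N) = CavityQED.electronMul v (Ψ : Amp N) +
      (g * phase p (p.hbar * dressedFreq p N) (-t)) • polCreat p N d (Ψ : Amp N) := by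
  set ψ : Amp N := (Ψ : Amp N) with hψ
  have hF := h.electronMul hv
  have e1 : (evolve p N t Ψ : Amp N) = phase p (ε + p.hbar * dressedFreq p N) t • ψ := by
    rw [coe_evolve_three h.isEigen (isEigen_zero p N 0) (isEigen_zero p N 0) (ψ := Ψ)
      (by simp [hψ]) t]
    simp
  -- The trailing zero fills the two-quantum slot of `coe_evolve_three`.
  have e2 : linearOp p d v g (evolve p N t Ψ : Amp N) =
      phase p (ε + p.hbar * dressedFreq p N) t • CavityQED.electronMul v ψ
        + (phase p (ε + p.hbar * dressedFreq p N) t * g) • polCreat p N d ψ + 0 := by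
    rw [e1, map_smul, h.linearOp_apply]
    module
  have e3 : (applyOp (linearOp p d v g) (evolve p N t Ψ) : Amp N) = _ :=
    (coe_applyOp (p := p) (by
      rw [e2, add_zero]
      exact Submodule.add_mem _ (Submodule.smul_mem _ _ (hF.mem_weighted 0))
        (Submodule.smul_mem _ _ (h.creat_mem_weighted d 0)))).trans e2
  rw [interaction, coe_evolve_three (hF.isEigen.smul _) ((h.isEigen_creat d).smul _)
    (isEigen_zero p N 0) e3 (-t)]
  have q := phase_mul_phase_neg p (ε + p.hbar * dressedFreq p N) t
  have q1 : phase p (ε + 2 * (p.hbar * dressedFreq p N)) (-t) =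
      phase p (ε + p.hbar * dressedFreq p N) (-t) * phase p (p.hbar * dressedFreq p N) (-t) := by
    rw [← phase_add]; congr 1; ring
  rw [q1]
  linear_combination (norm := module) q • CavityQED.electronMul v ψ +
    ((g : ℂ) * phase p (p.hbar * dressedFreq p N) (-t) * q) • polCreat p N d ψ

/-- Every component of the form `B†φ` is orthogonal to the vacuum. What remains is `v²`, independent
of the times, and the creation at `t'` followed by annihilation at `t`. -/
lemma inner_interaction_interaction (h : IsDressedVacuum p ε (Ψ : Amp N)) (h1 : ‖Ψ‖ = 1)
    (d : Fin 2) (hv : ∀ x (π : Equiv.Perm (Fin N)), v (x ∘ π) = v x) (g t t' : ℝ) :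
    inner ℂ Ψ (interaction p (linearOp p d v g) t (interaction p (linearOp p d v g) t' Ψ)) =
      pairing (Ψ : Amp N) (CavityQED.electronMul v (CavityQED.electronMul v (Ψ : Amp N))) +
        (g : ℂ) ^ 2 * phase p (p.hbar * dressedFreq p N) t *
          phase p (p.hbar * dressedFreq p N) (-t') := by
  set ψ : Amp N := (Ψ : Amp N) with hψ
  set Ω := p.hbar * dressedFreq p N with hΩ
  set c := phase p (ε + 2 * Ω) t * (g * phase p Ω (-t')) with hc
  have hF := h.electronMul hv
  have hF2 := hF.electronMul hv
  have e0 := h.coe_interaction d hv g t'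
  rw [← hψ, ← add_zero (_ + _)] at e0
  have e1 : (evolve p N t (interaction p (linearOp p d v g) t' Ψ) : Amp N) =
      phase p (ε + Ω) t • CavityQED.electronMul v ψ + c • polCreat p N d ψ := by
    rw [coe_evolve_three hF.isEigen ((h.isEigen_creat d).smul _) (isEigen_zero p N 0) e0 t, hc]
    module
  have e2 : linearOp p d v g (evolve p N t (interaction p (linearOp p d v g) t' Ψ) : Amp N) =
      (phase p (ε + Ω) t • CavityQED.electronMul v (CavityQED.electronMul v ψ) + (c * g) • ψ)
      + (phase p (ε + Ω) t * g + c) • polCreat p N d (CavityQED.electronMul v ψ)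
      + (c * g) • polCreat p N d (polCreat p N d ψ) := by
    rw [e1, map_add, map_smul, map_smul, hF.linearOp_apply, h.linearOp_creat]
    module
  have e3 : (applyOp (linearOp p d v g)
      (evolve p N t (interaction p (linearOp p d v g) t' Ψ)) : Amp N) = _ :=
    (coe_applyOp (p := p) (by
      rw [e2]
      exact Submodule.add_mem _ (Submodule.add_mem _ (Submodule.add_mem _
        (Submodule.smul_mem _ _ (hF2.mem_weighted 0)) (Submodule.smul_mem _ _ (h.mem_weighted 0)))
        (Submodule.smul_mem _ _ (hF.creat_mem_weighted d 0)))
        (Submodule.smul_mem _ _ (polCreat_mem_weighted d (h.creat_mem_weighted d 1))))).trans e2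
  have e4 := coe_evolve_three ((hF2.isEigen.smul _).add (h.isEigen.smul _))
    ((hF.isEigen_creat d).smul _) ((h.isEigen_creat_creat d).smul _) e3 (-t)
  rw [inner_eq_pairing]
  change pairing ψ (evolve p N (-t) (applyOp (linearOp p d v g)
      (evolve p N t (interaction p (linearOp p d v g) t' Ψ))) : Amp N) = _
  have m0 := h.mem_weighted 0
  have m1 := Submodule.smul_mem _ (phase p (ε + Ω) t) (hF2.mem_weighted 0)
  have m2 := Submodule.smul_mem _ (c * g) (h.mem_weighted 0)
  have m3 := Submodule.smul_mem _ (phase p (ε + Ω) (-t)) (Submodule.add_mem _ m1 m2)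
  have m4 := Submodule.smul_mem _ (phase p (ε + 2 * Ω) (-t)) (Submodule.smul_mem _
    (phase p (ε + Ω) t * g + c) (hF.creat_mem_weighted d 0))
  have m5 := Submodule.smul_mem _ (phase p (ε + 3 * Ω) (-t)) (Submodule.smul_mem _
    (c * g) (polCreat_mem_weighted (k := 0) d (h.creat_mem_weighted d 1)))
  rw [e4, pairing_add (p := p) m0 (Submodule.add_mem _ m3 m4) m5,
    pairing_add (p := p) m0 m3 m4, pairing_smul, pairing_add (p := p) m0 m1 m2, pairing_smul,
    pairing_smul, pairing_smul, pairing_smul, pairing_smul, pairing_smul,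
    h.pairing_creat d (hF.mem_weighted 1), h.pairing_creat d (h.creat_mem_weighted d 1),
    pairing_self ψ, ← norm_sq_eq, h1]
  have q := phase_mul_phase_neg p (ε + Ω) t
  have q1 : phase p (ε + 2 * Ω) t = phase p (ε + Ω) t * phase p Ω t := by
    rw [← phase_add]; congr 1; ring
  rw [hc, q1]
  push_cast
  linear_combination (pairing ψ (CavityQED.electronMul v (CavityQED.electronMul v ψ)) +
    (g : ℂ) ^ 2 * phase p Ω t * phase p Ω (-t')) * q

/-- The `v²` terms cancel in the commutator, and the two opposite phases combine to a sine. The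
result does not depend on `v`. -/
lemma response_linearOp (h : IsDressedVacuum p ε (Ψ : Amp N)) (h1 : ‖Ψ‖ = 1)
    (d : Fin 2) (hv : ∀ x (π : Equiv.Perm (Fin N)), v (x ∘ π) = v x) (g t t' : ℝ) :
    response p (linearOp p d v g) (linearOp p d v g) Ψ t t' =
      ((-(2 * g ^ 2 / p.hbar * ((if t' ≤ t then 1 else 0) *
        Real.sin (dressedFreq p N * (t - t')))) : ℝ) : ℂ) := by
  have hh : (p.hbar : ℂ) ≠ 0 := by exact_mod_cast p.hbar_pos.ne'
  rw [response, inner_sub_right, h.inner_interaction_interaction h1 d hv,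
    h.inner_interaction_interaction h1 d hv]
  have hph : ∀ s s' : ℝ, phase p (p.hbar * dressedFreq p N) s *
      phase p (p.hbar * dressedFreq p N) (-s') =
      Complex.exp (((dressedFreq p N * (s' - s) : ℝ) : ℂ) * Complex.I) := by
    intro s s'
    rw [phase, phase, ← Complex.exp_add]
    congr 1
    push_cast
    field_simp
    ring
  have e : dressedFreq p N * (t' - t) = -(dressedFreq p N * (t - t')) := by ring
  rw [mul_assoc _ (phase p _ t), mul_assoc _ (phase p _ t'), hph, hph, e]
  rw [Complex.exp_mul_I, Complex.exp_mul_I, Complex.ofReal_neg, Complex.cos_neg, Complex.sin_neg]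
  push_cast
  rw [apply_ite ((↑) : ℝ → ℂ), Complex.ofReal_one, Complex.ofReal_zero]
  linear_combination (2 * (g : ℂ) ^ 2 * (if t' ≤ t then 1 else 0) / p.hbar *
    Complex.sin (dressedFreq p N * (t - t'))) * Complex.I_mul_I

lemma response_vecPot (h : IsDressedVacuum p ε (Ψ : Amp N)) (h1 : ‖Ψ‖ = 1) (d : Fin 2)
    (t t' : ℝ) :
    response p (vecPot p N d) (vecPot p N d) Ψ t t' =
      ((-((if t' ≤ t then 1 else 0) * Real.sin (dressedFreq p N * (t - t')) /
        (p.eps0 * dressedFreq p N * volume p)) : ℝ) : ℂ) := by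
  rw [vecPot_eq_linearOp, h.response_linearOp h1 d
    (fun x π => by rw [displacement_comp]), dressedAmp_sq]
  have h1 := p.hbar_pos.ne'
  have h2 := (dressedFreq_pos p N).ne'
  have h3 := (volume_pos p).ne'
  have h5 := p.eps0_pos.ne'
  congr 1
  field_simp

lemma response_current (h : IsDressedVacuum p ε (Ψ : Amp N)) (h1 : ‖Ψ‖ = 1) (d : Fin 2)
    (t t' : ℝ) :
    response p (current p N d) (current p N d) Ψ t t' =
      ((p.charge ^ 2 * N / p.mass : ℝ) : ℂ) ^ 2 *
        response p (vecPot p N d) (vecPot p N d) Ψ t t' := by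
  rw [current_eq_linearOp, vecPot_eq_linearOp, h.response_linearOp h1 d
    (fun x π => by simp only [displacement_comp, totalWave_comp]), h.response_linearOp h1 d
    (fun x π => by simp only [displacement_comp])]
  push_cast
  ring

end IsDressedVacuum

lemma IsFermiSeaState.currentPara_apply {Ψ : State N} (h : IsFermiSeaState p N Ψ) (d : Fin 2) :
    currentPara p N d (Ψ : Amp N) = 0 := by
  rw [currentPara_eq]
  funext ⟨x, n⟩
  by_cases h0 : (Ψ : Amp N) (x, n) = 0
  · simp [h0]
  · simp [h.totalWave_eq_zero h0]

lemma IsFermiSeaState.applyOp_currentPara {Ψ : State N} (h : IsFermiSeaState p N Ψ)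
    (d : Fin 2) : applyOp (currentPara p N d) Ψ = 0 := by
  refine state_ext ?_
  rw [coe_applyOp (p := p) (by rw [h.currentPara_apply]; exact Submodule.zero_mem _),
    h.currentPara_apply]
  rfl

/-- On the Fermi sea the current only creates one quantum, a state orthogonal to the vacuum. -/
lemma IsFermiSeaState.inner_current {Ψ : State N} (h : IsFermiSeaState p N Ψ) (d : Fin 2) :
    inner ℂ Ψ (applyOp (current p N d) Ψ) = 0 := by
  obtain ⟨ε, hv⟩ := h.isDressedVacuum
  have hα : electronMul (displacement p d) (Ψ : Amp N) = 0 := by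
    funext ⟨x, n⟩
    by_cases h0 : (Ψ : Amp N) (x, n) = 0
    · simp [h0]
    · simp [displacement, h.totalWave_eq_zero h0]
  have e : current p N d (Ψ : Amp N) =
      (((-(p.charge ^ 2 * N / p.mass) : ℝ) : ℂ) * (dressedAmp p N : ℂ)) •
        polCreat p N d (Ψ : Amp N) := by
    rw [current, LinearMap.add_apply, h.currentPara_apply, currentDia, vecPot_eq]
    simp only [LinearMap.smul_apply, LinearMap.add_apply, hv.annih, hα, smul_zero, zero_add,
      add_zero, smul_smul]
  have hm := hv.creat_mem_weighted d
  rw [inner_eq_pairing, coe_applyOp (p := p) (by rw [e]; exact Submodule.smul_mem _ _ (hm 0)), e,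
    pairing_smul, hv.pairing_creat d (hv.mem_weighted 1), mul_zero]

/-! ### Laplace transform of a retarded oscillation -/

lemma retarded_sin_eq (z : ℂ) (ν : ℝ) :
    (fun τ : ℝ => Complex.exp (Complex.I * z * τ) *
        (((if 0 ≤ τ then 1 else 0) * Real.sin (ν * τ) : ℝ) : ℂ)) =
      (Set.Ici (0 : ℝ)).indicator fun τ : ℝ => 1 / (2 * Complex.I) *
        (Complex.exp (Complex.I * (z + ν) * τ) - Complex.exp (Complex.I * (z - ν) * τ)) := by
  funext τ
  by_cases h : 0 ≤ τ
  · rw [Set.indicator_of_mem (Set.mem_Ici.2 h), if_pos h, one_mul, Complex.ofReal_sin, Complex.sin]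
    have e1 : Complex.I * (z + ν) * τ = Complex.I * z * τ + ((ν * τ : ℝ) : ℂ) * Complex.I := by
      push_cast; ring
    have e2 : Complex.I * (z - ν) * τ = Complex.I * z * τ + -((ν * τ : ℝ) : ℂ) * Complex.I := by
      push_cast; ring
    rw [e1, e2, Complex.exp_add, Complex.exp_add]
    have : (1 : ℂ) / (2 * Complex.I) = -Complex.I / 2 := by
      rw [one_div, mul_inv, Complex.inv_I]; ring
    rw [this]
    ring
  · rw [Set.indicator_of_notMem (by simpa using h), if_neg h]
    simp

lemma I_mul_add_re_neg {z : ℂ} (hz : 0 < z.im) (ν : ℝ) : (Complex.I * (z + ν)).re < 0 := by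
  simpa using hz

lemma I_mul_sub_re_neg {z : ℂ} (hz : 0 < z.im) (ν : ℝ) : (Complex.I * (z - ν)).re < 0 := by
  simpa using hz

lemma integrable_retarded_sin {z : ℂ} (hz : 0 < z.im) (ν : ℝ) :
    Integrable fun τ : ℝ => Complex.exp (Complex.I * z * τ) *
        (((if 0 ≤ τ then 1 else 0) * Real.sin (ν * τ) : ℝ) : ℂ) := by
  rw [retarded_sin_eq, integrable_indicator_iff measurableSet_Ici,
    integrableOn_Ici_iff_integrableOn_Ioi]
  exact ((integrableOn_exp_mul_complex_Ioi (I_mul_add_re_neg hz ν) 0).sub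
    (integrableOn_exp_mul_complex_Ioi (I_mul_sub_re_neg hz ν) 0)).const_mul _

lemma ne_ofReal_of_im_pos {z : ℂ} (hz : 0 < z.im) (ν : ℝ) : z ≠ ν := by
  rintro rfl
  simp at hz

lemma add_ofReal_ne_zero {z : ℂ} (hz : 0 < z.im) (ν : ℝ) : z + ν ≠ 0 := fun h =>
  ne_ofReal_of_im_pos hz (-ν) (by rw [Complex.ofReal_neg]; exact eq_neg_of_add_eq_zero_left h)

lemma integral_retarded_sin {z : ℂ} (hz : 0 < z.im) (ν : ℝ) :
    ∫ τ : ℝ, Complex.exp (Complex.I * z * τ) *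
        (((if 0 ≤ τ then 1 else 0) * Real.sin (ν * τ) : ℝ) : ℂ) =
      1 / 2 * (1 / (z + ν) - 1 / (z - ν)) := by
  have h1 := add_ofReal_ne_zero hz ν
  have h2 := sub_ne_zero.2 (ne_ofReal_of_im_pos hz ν)
  rw [retarded_sin_eq, integral_indicator measurableSet_Ici, integral_Ici_eq_integral_Ioi,
    integral_const_mul, integral_sub (integrableOn_exp_mul_complex_Ioi (I_mul_add_re_neg hz ν) 0)
    (integrableOn_exp_mul_complex_Ioi (I_mul_sub_re_neg hz ν) 0),
    integral_exp_mul_complex_Ioi (I_mul_add_re_neg hz ν),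
    integral_exp_mul_complex_Ioi (I_mul_sub_re_neg hz ν)]
  simp only [Complex.ofReal_zero, mul_zero, Complex.exp_zero]
  have hI := Complex.I_ne_zero
  field_simp
  linear_combination (2 * (ν : ℂ)) * Complex.I_sq

/-! ### Optical conductivity -/

/-- The propagator of the vector potential at complex frequencies. -/
def propagator (p : Params) (N : ℕ) (z : ℂ) : ℂ :=
  -1 / ((2 * p.eps0 * dressedFreq p N * volume p : ℝ) : ℂ) *
    (1 / (z + dressedFreq p N) - 1 / (z - dressedFreq p N))

/-- The optical conductivity at complex frequencies. -/
def opticalConductivity (p : Params) (N : ℕ) (z : ℂ) : ℂ :=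
  Complex.I * p.eps0 * (plasmaFreq p N : ℂ) ^ 2 / z -
    Complex.I * p.eps0 * (plasmaFreq p N : ℂ) ^ 4 / (z * (2 * dressedFreq p N)) *
      (1 / (z + dressedFreq p N) - 1 / (z - dressedFreq p N))

lemma charge_sq_mul_div (p : Params) (N : ℕ) :
    p.charge ^ 2 * N / p.mass = p.eps0 * volume p * plasmaFreq p N ^ 2 := by
  have h3 := (volume_pos p).ne'
  have h4 := p.mass_pos.ne'
  have h5 := p.eps0_pos.ne'
  rw [plasmaFreq_sq]
  field_simp

lemma charge_sq_mul_density (p : Params) (N : ℕ) :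
    p.charge ^ 2 * density p N / p.mass = p.eps0 * plasmaFreq p N ^ 2 := by
  have h3 := (volume_pos p).ne'
  have h4 := p.mass_pos.ne'
  have h5 := p.eps0_pos.ne'
  rw [plasmaFreq_sq, density]
  field_simp

namespace IsDressedVacuum

variable {ε : ℝ} {Ψ : State N}

lemma response_vecPot_zero (h : IsDressedVacuum p ε (Ψ : Amp N)) (h1 : ‖Ψ‖ = 1) (d : Fin 2)
    (τ : ℝ) :
    response p (vecPot p N d) (vecPot p N d) Ψ τ 0 =
      ((-1 / (p.eps0 * dressedFreq p N * volume p) : ℝ) : ℂ) *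
        (((if 0 ≤ τ then 1 else 0) * Real.sin (dressedFreq p N * τ) : ℝ) : ℂ) := by
  rw [h.response_vecPot h1, sub_zero, ← Complex.ofReal_mul]
  congr 1
  ring

lemma responseFreq_vecPot (h : IsDressedVacuum p ε (Ψ : Amp N)) (h1 : ‖Ψ‖ = 1) (d : Fin 2)
    {z : ℂ} (hz : 0 < z.im) :
    responseFreq p (vecPot p N d) (vecPot p N d) Ψ z = propagator p N z := by
  simp only [responseFreq, h.response_vecPot_zero h1, mul_left_comm (Complex.exp _)]
  rw [integral_const_mul, integral_retarded_sin hz, propagator]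
  push_cast
  ring

lemma integrable_response_current (h : IsDressedVacuum p ε (Ψ : Amp N)) (h1 : ‖Ψ‖ = 1)
    (d : Fin 2) {z : ℂ} (hz : 0 < z.im) :
    Integrable fun τ : ℝ => Complex.exp (Complex.I * z * τ) *
      response p (current p N d) (current p N d) Ψ τ 0 := by
  simp only [h.response_current h1, h.response_vecPot_zero h1, mul_left_comm (Complex.exp _)]
  exact ((integrable_retarded_sin hz _).const_mul _).const_mul _

lemma responseFreq_current (h : IsDressedVacuum p ε (Ψ : Amp N)) (h1 : ‖Ψ‖ = 1) (d : Fin 2)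
    (z : ℂ) :
    responseFreq p (current p N d) (current p N d) Ψ z =
      ((p.charge ^ 2 * N / p.mass : ℝ) : ℂ) ^ 2 *
        responseFreq p (vecPot p N d) (vecPot p N d) Ψ z := by
  simp only [responseFreq, h.response_current h1, mul_left_comm (Complex.exp _)]
  rw [integral_const_mul]

lemma conductivity_eq_drude_add (h : IsDressedVacuum p ε (Ψ : Amp N)) (h1 : ‖Ψ‖ = 1)
    (d : Fin 2) (z : ℂ) :
    conductivity p d Ψ z = drudeTerm p N z +
      Complex.I * ((p.charge ^ 2 * N / p.mass : ℝ) : ℂ) ^ 2 / ((volume p : ℂ) * z) *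
        responseFreq p (vecPot p N d) (vecPot p N d) Ψ z := by
  rw [conductivity, h.responseFreq_current h1, charge_sq_mul_density, drudeTerm, div_mul_eq_div_div,
    div_eq_mul_inv _ Complex.I, Complex.inv_I]
  rw [div_mul_eq_div_div _ _ z]
  ring

lemma conductivity_eq (h : IsDressedVacuum p ε (Ψ : Amp N)) (h1 : ‖Ψ‖ = 1)
    (d : Fin 2) {z : ℂ} (hz : 0 < z.im) :
    conductivity p d Ψ z = opticalConductivity p N z := by
  have h0 : (volume p : ℂ) ≠ 0 := by exact_mod_cast (volume_pos p).ne'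
  have h2 : (p.eps0 : ℂ) ≠ 0 := by exact_mod_cast p.eps0_pos.ne'
  have h3 : (dressedFreq p N : ℂ) ≠ 0 := by exact_mod_cast (dressedFreq_pos p N).ne'
  have h4 : z ≠ 0 := by simpa using ne_ofReal_of_im_pos hz 0
  have e : Complex.I * ((p.charge ^ 2 * N / p.mass : ℝ) : ℂ) ^ 2 / ((volume p : ℂ) * z) *
      (-1 / ((2 * p.eps0 * dressedFreq p N * volume p : ℝ) : ℂ)) =
      -(Complex.I * p.eps0 * (plasmaFreq p N : ℂ) ^ 4 / (z * (2 * dressedFreq p N))) := by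
    rw [charge_sq_mul_div]
    push_cast
    field_simp
  rw [h.conductivity_eq_drude_add h1, h.responseFreq_vecPot h1 d hz, drudeTerm, propagator,
    opticalConductivity, ← mul_assoc (Complex.I * _ / _), e]
  push_cast
  ring

lemma response_current_sub (h : IsDressedVacuum p ε (Ψ : Amp N)) (h1 : ‖Ψ‖ = 1) (d : Fin 2)
    (t t' : ℝ) :
    response p (current p N d) (current p N d) Ψ t t' =
      response p (current p N d) (current p N d) Ψ (t - t') 0 := by
  simp only [h.response_current h1, h.response_vecPot h1, sub_zero, sub_nonneg]

/-- The Laplace transform of the induced current density. -/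
lemma laplace_inducedCurrent (h : IsDressedVacuum p ε (Ψ : Amp N)) (h1 : ‖Ψ‖ = 1)
    (d : Fin 2) {z : ℂ} (hz : 0 < z.im) {A : ℝ → ℝ} (hA : ContDiff ℝ 1 A)
    (hA0 : ∀ t ≤ 0, A t = 0)
    (hi : Integrable fun t : ℝ => Complex.exp (Complex.I * z * t) * (A t : ℂ))
    (hi' : Integrable fun t : ℝ => Complex.exp (Complex.I * z * t) * ((deriv A t : ℝ) : ℂ)) :
    Integrable (fun t : ℝ => Complex.exp (Complex.I * z * t) * inducedCurrent p d Ψ A t) ∧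
    ∫ t : ℝ, Complex.exp (Complex.I * z * t) * inducedCurrent p d Ψ A t =
      conductivity p d Ψ z *
        ∫ t : ℝ, Complex.exp (Complex.I * z * t) * ((-(deriv A t) : ℝ) : ℂ) := by
  set f : ℝ → ℂ := fun τ => Complex.exp (Complex.I * z * τ) *
      response p (current p N d) (current p N d) Ψ τ 0 with hf
  set a : ℝ → ℂ := fun t => Complex.exp (Complex.I * z * t) * (A t : ℂ) with ha
  have hfi : Integrable f := h.integrable_response_current h1 d hz
  set L := ContinuousLinearMap.mul ℂ ℂ
  set G : ℂ := ((p.charge ^ 2 * N / p.mass : ℝ) : ℂ) with hG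
  -- The factor `e^{izt} = e^{izt'} e^{iz(t-t')}` is split between field and kernel, turning the
  -- response integral into a convolution of integrable functions; as `A` vanishes up to time `0`,
  -- it extends to the whole line.
  have hconv : ∀ t : ℝ, Complex.exp (Complex.I * z * t) * inducedCurrent p d Ψ A t =
      (-G * a t - convolution a f L MeasureTheory.volume t) / (volume p : ℂ) := by
    intro t
    have : convolution a f L MeasureTheory.volume t = Complex.exp (Complex.I * z * t) *
        ∫ t' in Set.Ioi (0 : ℝ),
          response p (current p N d) (current p N d) Ψ t t' * (A t' : ℂ) := by
      rw [convolution_def, setIntegral_eq_integral_of_forall_compl_eq_zero, ← integral_const_mul]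
      · refine integral_congr_ae (Eventually.of_forall fun t' => ?_)
        simp only [L, ContinuousLinearMap.mul_apply', hf, ha]
        rw [h.response_current_sub h1 d t t']
        have e : Complex.exp (Complex.I * z * t) = Complex.exp (Complex.I * z * t') *
            Complex.exp (Complex.I * z * ((t - t' : ℝ) : ℂ)) := by
          rw [← Complex.exp_add]
          congr 1
          push_cast
          ring
        rw [e]
        ring
      · intro t' ht'
        rw [hA0 t' (not_lt.1 ht')]
        simp
    rw [inducedCurrent, this, ← hG]
    simp only [ha]
    ring
  have hcI : Integrable (convolution a f L MeasureTheory.volume) :=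
    hi.integrable_convolution L hfi
  -- Integration by parts, which is the source of the `1/(iz)` in the Kubo formula.
  have hparts : ∫ t : ℝ, Complex.exp (Complex.I * z * t) * ((-(deriv A t) : ℝ) : ℂ) =
      Complex.I * z * ∫ t, a t := by
    have hd : ∀ t : ℝ, HasDerivAt a (Complex.I * z * a t +
        Complex.exp (Complex.I * z * t) * ((deriv A t : ℝ) : ℂ)) t := by
      intro t
      have e1 := ((hasDerivAt_id t).ofReal_comp.const_mul (Complex.I * z)).cexp
      have e2 := ((hA.differentiable one_ne_zero) t).hasDerivAt.ofReal_comp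
      refine (e1.mul e2).congr_deriv ?_
      simp only [ha, id, Complex.ofReal_one]
      ring
    have h0 := integral_eq_zero_of_hasDerivAt_of_integrable hd ((hi.const_mul _).add hi') hi
    rw [integral_add (hi.const_mul _) hi', integral_const_mul] at h0
    simp only [Complex.ofReal_neg, mul_neg]
    rw [integral_neg]
    linear_combination -h0
  have hz0 : z ≠ 0 := by simpa using ne_ofReal_of_im_pos hz 0
  have h0 : (volume p : ℂ) ≠ 0 := by exact_mod_cast (volume_pos p).ne'
  have hI := Complex.I_ne_zero
  simp only [hconv]
  refine ⟨((hi.const_mul _).sub hcI).div_const _, ?_⟩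
  rw [integral_div, integral_sub (hi.const_mul _) hcI, integral_const_mul, hparts,
    integral_convolution L hi hfi, conductivity, responseFreq, charge_sq_mul_density, hG,
    charge_sq_mul_div]
  simp only [L, ContinuousLinearMap.mul_apply']
  push_cast
  field_simp
  ring

end IsDressedVacuum

/-! ### Poles -/

lemma meromorphicOrderAt_eq_neg_one {f g : ℂ → ℂ} {z₀ : ℂ} (hg : AnalyticAt ℂ g z₀)
    (h0 : g z₀ ≠ 0) (h : ∀ᶠ z in 𝓝[≠] z₀, f z = g z / (z - z₀)) :
    MeromorphicAt f z₀ ∧ meromorphicOrderAt f z₀ = -1 := by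
  have hm : MeromorphicAt f z₀ :=
    (hg.meromorphicAt.div (analyticAt_id.sub analyticAt_const).meromorphicAt).congr
      (h.mono fun z hz => by simpa using hz.symm)
  refine ⟨hm, ?_⟩
  have := (meromorphicOrderAt_eq_int_iff (n := -1) hm).2 ⟨g, hg, h0, h.mono fun z hz => by
    rw [hz, zpow_neg_one, smul_eq_mul, div_eq_inv_mul]⟩
  simpa using this

lemma analyticAt_propagator {z : ℂ} (h1 : z ≠ dressedFreq p N) (h2 : z ≠ -dressedFreq p N) :
    AnalyticAt ℂ (propagator p N) z := by
  have h1' := sub_ne_zero.2 h1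
  have h2' : z + dressedFreq p N ≠ 0 := fun h => h2 (eq_neg_of_add_eq_zero_left h)
  exact analyticAt_const.mul
    ((analyticAt_const.div (analyticAt_id.add analyticAt_const) h2').sub
      (analyticAt_const.div (analyticAt_id.sub analyticAt_const) h1'))

lemma analyticAt_opticalConductivity {z : ℂ} (h0 : z ≠ 0) (h1 : z ≠ dressedFreq p N)
    (h2 : z ≠ -dressedFreq p N) : AnalyticAt ℂ (opticalConductivity p N) z := by
  have h1' := sub_ne_zero.2 h1
  have h2' : z + dressedFreq p N ≠ 0 := fun h => h2 (eq_neg_of_add_eq_zero_left h)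
  have h3 : (dressedFreq p N : ℂ) ≠ 0 := by exact_mod_cast (dressedFreq_pos p N).ne'
  exact (analyticAt_const.div analyticAt_id h0).sub
    ((analyticAt_const.div (analyticAt_id.mul analyticAt_const)
      (mul_ne_zero h0 (mul_ne_zero two_ne_zero h3))).mul
    ((analyticAt_const.div (analyticAt_id.add analyticAt_const) h2').sub
      (analyticAt_const.div (analyticAt_id.sub analyticAt_const) h1')))

lemma propagator_eq {z : ℂ} (h1 : z ≠ dressedFreq p N) (h2 : z ≠ -dressedFreq p N) :
    propagator p N z = 1 / (p.eps0 * volume p : ℂ) /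
      ((z - dressedFreq p N) * (z + dressedFreq p N)) := by
  have h1' := sub_ne_zero.2 h1
  have h2' : z + dressedFreq p N ≠ 0 := fun h => h2 (eq_neg_of_add_eq_zero_left h)
  have h3 : (dressedFreq p N : ℂ) ≠ 0 := by exact_mod_cast (dressedFreq_pos p N).ne'
  have h4 : (volume p : ℂ) ≠ 0 := by exact_mod_cast (volume_pos p).ne'
  have h5 : (p.eps0 : ℂ) ≠ 0 := by exact_mod_cast p.eps0_pos.ne'
  rw [propagator]
  push_cast
  field_simp
  ring

/-- Over a common denominator the numerator is `z² - ω̃² + ω_p² = z² - ω²`. It equals `-ω²` at `0`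
and `ω_p²` at `±ω̃`, so no pole cancels. -/
lemma opticalConductivity_eq {z : ℂ} (h0 : z ≠ 0) (h1 : z ≠ dressedFreq p N)
    (h2 : z ≠ -dressedFreq p N) :
    opticalConductivity p N z = Complex.I * p.eps0 * plasmaFreq p N ^ 2 *
      (z ^ 2 - p.omega ^ 2) / (z * ((z - dressedFreq p N) * (z + dressedFreq p N))) := by
  have h1' := sub_ne_zero.2 h1
  have h2' : z + dressedFreq p N ≠ 0 := fun h => h2 (eq_neg_of_add_eq_zero_left h)
  have h3 : (dressedFreq p N : ℂ) ≠ 0 := by exact_mod_cast (dressedFreq_pos p N).ne'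
  have e : (plasmaFreq p N : ℂ) ^ 2 = (dressedFreq p N : ℂ) ^ 2 - (p.omega : ℂ) ^ 2 := by
    have := dressedFreq_sq p N
    rw [eq_sub_iff_add_eq]
    exact_mod_cast (by linarith : plasmaFreq p N ^ 2 + p.omega ^ 2 = dressedFreq p N ^ 2)
  have e4 : (plasmaFreq p N : ℂ) ^ 4 =
      plasmaFreq p N ^ 2 * ((dressedFreq p N : ℂ) ^ 2 - (p.omega : ℂ) ^ 2) := by
    rw [← e]; ring
  rw [opticalConductivity, e4]
  field_simp
  ring

lemma propagator_order {z : ℂ} (h : z = dressedFreq p N ∨ z = -dressedFreq p N) :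
    MeromorphicAt (propagator p N) z ∧ meromorphicOrderAt (propagator p N) z = -1 := by
  have h3 : (dressedFreq p N : ℂ) ≠ 0 := by exact_mod_cast (dressedFreq_pos p N).ne'
  have h4 : (volume p : ℂ) ≠ 0 := by exact_mod_cast (volume_pos p).ne'
  have h5 : (p.eps0 : ℂ) ≠ 0 := by exact_mod_cast p.eps0_pos.ne'
  have hc : 1 / (p.eps0 * volume p : ℂ) ≠ 0 := one_div_ne_zero (mul_ne_zero h5 h4)
  have hne : (dressedFreq p N : ℂ) ≠ -dressedFreq p N := self_ne_neg.2 h3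
  rcases h with rfl | rfl
  · have hs : (dressedFreq p N : ℂ) + dressedFreq p N ≠ 0 := by
      rw [← two_mul]; exact mul_ne_zero two_ne_zero h3
    refine meromorphicOrderAt_eq_neg_one
      (g := fun z => 1 / (p.eps0 * volume p : ℂ) / (z + dressedFreq p N))
      (analyticAt_const.div (analyticAt_id.add analyticAt_const) hs) (div_ne_zero hc hs) ?_
    filter_upwards [self_mem_nhdsWithin, eventually_nhdsWithin_of_eventually_nhds
      (eventually_ne_nhds hne)] with z hz1 hz2
    rw [propagator_eq hz1 hz2, mul_comm (z - _), div_mul_eq_div_div]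
  · have hs : -(dressedFreq p N : ℂ) - dressedFreq p N ≠ 0 := sub_ne_zero.2 hne.symm
    refine meromorphicOrderAt_eq_neg_one
      (g := fun z => 1 / (p.eps0 * volume p : ℂ) / (z - dressedFreq p N))
      (analyticAt_const.div (analyticAt_id.sub analyticAt_const) hs) (div_ne_zero hc hs) ?_
    filter_upwards [self_mem_nhdsWithin, eventually_nhdsWithin_of_eventually_nhds
      (eventually_ne_nhds hne.symm)] with z hz1 hz2
    rw [propagator_eq hz2 hz1, sub_neg_eq_add, div_mul_eq_div_div]

lemma opticalConductivity_order (hN : 1 ≤ N) {z : ℂ}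
    (h : z = 0 ∨ z = dressedFreq p N ∨ z = -dressedFreq p N) :
    MeromorphicAt (opticalConductivity p N) z ∧
      meromorphicOrderAt (opticalConductivity p N) z = -1 := by
  have h3 : (dressedFreq p N : ℂ) ≠ 0 := by exact_mod_cast (dressedFreq_pos p N).ne'
  have h5 : (p.eps0 : ℂ) ≠ 0 := by exact_mod_cast p.eps0_pos.ne'
  have h6 : (p.omega : ℂ) ≠ 0 := by exact_mod_cast p.omega_pos.ne'
  have h7 : (plasmaFreq p N : ℂ) ^ 2 ≠ 0 := by exact_mod_cast (plasmaFreq_sq_pos p hN).ne'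
  have e : (dressedFreq p N : ℂ) ^ 2 - (p.omega : ℂ) ^ 2 = (plasmaFreq p N : ℂ) ^ 2 := by
    rw [sub_eq_iff_eq_add']
    exact_mod_cast dressedFreq_sq p N
  have hc : Complex.I * p.eps0 * (plasmaFreq p N : ℂ) ^ 2 ≠ 0 :=
    mul_ne_zero (mul_ne_zero Complex.I_ne_zero h5) h7
  have hne : (dressedFreq p N : ℂ) ≠ -dressedFreq p N := self_ne_neg.2 h3
  have hnum : ∀ z₀ : ℂ, AnalyticAt ℂ (fun z : ℂ => Complex.I * p.eps0 * (plasmaFreq p N : ℂ) ^ 2 *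
      (z ^ 2 - (p.omega : ℂ) ^ 2)) z₀ := fun z₀ =>
    analyticAt_const.mul ((analyticAt_id.pow 2).sub analyticAt_const)
  have hp : ∀ z₀ : ℂ, AnalyticAt ℂ (fun z : ℂ => z + dressedFreq p N) z₀ := fun z₀ =>
    analyticAt_id.add analyticAt_const
  have hm : ∀ z₀ : ℂ, AnalyticAt ℂ (fun z : ℂ => z - dressedFreq p N) z₀ := fun z₀ =>
    analyticAt_id.sub analyticAt_const
  have hev : ∀ {z₀ z₁ : ℂ}, z₀ ≠ z₁ → ∀ᶠ z in 𝓝[≠] z₀, z ≠ z₁ := fun h =>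
    eventually_nhdsWithin_of_eventually_nhds (eventually_ne_nhds h)
  rcases h with rfl | rfl | rfl
  · have hd : ((0 : ℂ) - dressedFreq p N) * (0 + dressedFreq p N) ≠ 0 := by simpa using h3
    refine meromorphicOrderAt_eq_neg_one
      ((hnum 0).div ((hm 0).mul (hp 0)) hd) (div_ne_zero (mul_ne_zero hc ?_) hd) ?_
    · simpa using h6
    filter_upwards [self_mem_nhdsWithin, hev h3.symm, hev (neg_ne_zero.2 h3).symm]
      with z hz0 hz1 hz2
    rw [opticalConductivity_eq hz0 hz1 hz2, sub_zero, mul_comm z]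
    simp only [Pi.div_apply, Pi.mul_apply]
    rw [div_div]
  · have hd : (dressedFreq p N : ℂ) * (dressedFreq p N + dressedFreq p N) ≠ 0 := by
      rw [← two_mul]; exact mul_ne_zero h3 (mul_ne_zero two_ne_zero h3)
    refine meromorphicOrderAt_eq_neg_one
      ((hnum _).div (analyticAt_id.mul (hp _)) hd) (div_ne_zero (mul_ne_zero hc ?_) hd) ?_
    · rwa [e]
    filter_upwards [self_mem_nhdsWithin, hev h3, hev hne] with z hz1 hz0 hz2
    rw [opticalConductivity_eq hz0 hz1 hz2]
    simp only [Pi.div_apply, Pi.mul_apply, id]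
    rw [div_div]
    congr 1
    ring
  · have hd : -(dressedFreq p N : ℂ) * (-dressedFreq p N - dressedFreq p N) ≠ 0 :=
      mul_ne_zero (neg_ne_zero.2 h3) (sub_ne_zero.2 hne.symm)
    refine meromorphicOrderAt_eq_neg_one
      ((hnum _).div (analyticAt_id.mul (hm _)) hd) (div_ne_zero (mul_ne_zero hc ?_) hd) ?_
    · rwa [neg_sq, e]
    filter_upwards [self_mem_nhdsWithin, hev (neg_ne_zero.2 h3), hev hne.symm] with z hz2 hz0 hz1
    rw [opticalConductivity_eq hz0 hz1 hz2]
    simp only [Pi.div_apply, Pi.mul_apply, id]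
    rw [div_div]
    congr 1
    ring

/-! ### The Drude peak -/

lemma tendsto_opticalConductivity {w : ℝ} (h0 : w ≠ 0) (h1 : w ≠ dressedFreq p N)
    (h2 : w ≠ -dressedFreq p N) :
    Tendsto (fun η : ℝ => opticalConductivity p N ((w : ℂ) + Complex.I * η)) (𝓝[>] 0)
      (𝓝 (opticalConductivity p N w)) := by
  have hc := (analyticAt_opticalConductivity (p := p) (N := N) (z := (w : ℂ))
    (by exact_mod_cast h0) (by exact_mod_cast h1) (by exact_mod_cast h2)).continuousAt
  refine hc.tendsto.comp (Tendsto.mono_left ?_ nhdsWithin_le_nhds)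
  have : Continuous fun η : ℝ => (w : ℂ) + Complex.I * η := by fun_prop
  simpa using this.tendsto 0

/-- The DC conductivity in the cavity at finite broadening. -/
def dcConductivity (p : Params) (N : ℕ) (η : ℝ) : ℝ :=
  p.eps0 * plasmaFreq p N ^ 2 / η *
    (1 - coupling p N / (1 + η ^ 2 / dressedFreq p N ^ 2))

/-- On the imaginary axis `z²` is real and the factors `i` cancel, leaving `ε₀ω_p²/η` times `(η² +
ω²)/(η² + ω̃²)`. -/
lemma opticalConductivity_I_mul {η : ℝ} (hη : 0 < η) :
    opticalConductivity p N (Complex.I * η) = dcConductivity p N η := by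
  have him : 0 < (Complex.I * η).im := by simpa using hη
  have h0 : Complex.I * η ≠ 0 := by simpa using ne_ofReal_of_im_pos him 0
  have hω := dressedFreq_pos p N
  rw [opticalConductivity_eq h0 (ne_ofReal_of_im_pos him _)
    (by simpa using ne_ofReal_of_im_pos him (-dressedFreq p N))]
  have e1 : (Complex.I * η - dressedFreq p N) * (Complex.I * η + dressedFreq p N) =
      ((-(η ^ 2 + dressedFreq p N ^ 2) : ℝ) : ℂ) := by
    push_cast
    linear_combination (η : ℂ) ^ 2 * Complex.I_sq
  have e2 : (Complex.I * η) ^ 2 - (p.omega : ℂ) ^ 2 = ((-(η ^ 2 + p.omega ^ 2) : ℝ) : ℂ) := by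
    push_cast
    linear_combination (η : ℂ) ^ 2 * Complex.I_sq
  have e3 : p.omega ^ 2 = dressedFreq p N ^ 2 - plasmaFreq p N ^ 2 := by
    rw [dressedFreq_sq]; ring
  rw [e1, e2, mul_assoc Complex.I, mul_assoc Complex.I, mul_assoc Complex.I,
    mul_div_mul_left _ _ Complex.I_ne_zero]
  norm_cast
  rw [dcConductivity, coupling, e3]
  have : η ^ 2 + dressedFreq p N ^ 2 ≠ 0 := by positivity
  have : -(η ^ 2 + dressedFreq p N ^ 2) ≠ 0 := neg_ne_zero.2 this
  field_simp
  ring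

lemma drudeTerm_I_mul (η : ℝ) :
    drudeTerm p N (Complex.I * η) = ((p.eps0 * plasmaFreq p N ^ 2 / η : ℝ) : ℂ) := by
  rw [drudeTerm, mul_div_mul_left _ _ Complex.I_ne_zero]
  push_cast
  rfl

lemma tendsto_re_add_I_mul {f : ℂ → ℂ} {η c : ℝ} (hf : ContinuousAt f (Complex.I * η))
    (hc : f (Complex.I * η) = c) :
    Tendsto (fun w : ℝ => (f ((w : ℂ) + Complex.I * η)).re) (𝓝 0) (𝓝 c) := by
  have : Continuous fun w : ℝ => (w : ℂ) + Complex.I * η := by fun_prop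
  have h0 := this.tendsto 0
  simp only [Complex.ofReal_zero, zero_add] at h0
  have := (Complex.continuous_re.tendsto _).comp (hf.tendsto.comp h0)
  rwa [hc, Complex.ofReal_re] at this

lemma tendsto_dcConductivity_div (p : Params) (hN : 1 ≤ N) :
    Tendsto (fun η : ℝ => dcConductivity p N η / (p.eps0 * plasmaFreq p N ^ 2 / η)) (𝓝[>] 0)
      (𝓝 (1 - coupling p N)) := by
  have hω := dressedFreq_pos p N
  have h5 := p.eps0_pos
  have h7 := plasmaFreq_sq_pos p hN
  have hcont : ContinuousAt (fun η : ℝ => 1 - coupling p N / (1 + η ^ 2 / dressedFreq p N ^ 2)) 0 :=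
    continuousAt_const.sub (continuousAt_const.div (by fun_prop) (by simp))
  have := hcont.tendsto.mono_left (nhdsWithin_le_nhds (s := Set.Ioi 0))
  simp only [ne_eq, OfNat.ofNat_ne_zero, not_false_eq_true, zero_pow, zero_div, add_zero,
    div_one] at this
  refine this.congr' ?_
  filter_upwards [self_mem_nhdsWithin] with η hη
  rw [dcConductivity, mul_div_cancel_left₀]
  exact (div_pos (mul_pos h5 h7) hη).ne'

lemma tendsto_dcConductivity_sub (p : Params) (N : ℕ) :
    Tendsto (fun η : ℝ => dcConductivity p N η -
      p.eps0 * plasmaFreq p N ^ 2 / η * (1 - coupling p N)) (𝓝[>] 0) (𝓝 0) := by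
  have hω := dressedFreq_pos p N
  -- The exact difference: `1 - 1/(1 + η²/ω̃²)` is of order `η²`, which beats the `1/η` of the Drude
  -- peak.
  have hcont : ContinuousAt (fun η : ℝ => p.eps0 * plasmaFreq p N ^ 2 * coupling p N * η /
      (dressedFreq p N ^ 2 + η ^ 2)) 0 :=
    ContinuousAt.div (by fun_prop) (by fun_prop) (by positivity)
  have := hcont.tendsto.mono_left (nhdsWithin_le_nhds (s := Set.Ioi 0))
  simp only [mul_zero, zero_div] at this
  refine this.congr' ?_
  filter_upwards [self_mem_nhdsWithin] with η hη
  have hη' : (0 : ℝ) < η := hη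
  rw [dcConductivity]
  field_simp
  ring

end CavityQED

end

/-! ### Assembly of the claims for both kinds of state. -/

theorem mainTheorem5 (p : CavityQED.Params) (N : ℕ) (hN : 1 ≤ N) :
    (∃ Ψ : CavityQED.State N, CavityQED.IsGroundState p N Ψ) ∧
    (0 < CavityQED.coupling p N ∧ CavityQED.coupling p N < 1) ∧
    ∀ (Ψ : CavityQED.State N) (d : Fin 2),
      (CavityQED.IsGroundState p N Ψ ∨ CavityQED.IsFermiSeaState p N Ψ) →
      -- the Fermi sea carries no current
      (CavityQED.IsFermiSeaState p N Ψ →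
        CavityQED.applyOp (CavityQED.currentPara p N d) Ψ = 0 ∧
        inner ℂ Ψ (CavityQED.applyOp (CavityQED.current p N d) Ψ) = 0) ∧
      -- the propagator of the vector potential and the current-current response, in time
      (∀ t t' : ℝ,
        CavityQED.response p (CavityQED.vecPot p N d) (CavityQED.vecPot p N d) Ψ t t' =
          ((-((if t' ≤ t then 1 else 0) * Real.sin (CavityQED.dressedFreq p N * (t - t')) /
            (p.eps0 * CavityQED.dressedFreq p N * CavityQED.volume p)) : ℝ) : ℂ) ∧
        CavityQED.response p (CavityQED.current p N d) (CavityQED.current p N d) Ψ t t' =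
          ((p.charge ^ 2 * N / p.mass : ℝ) : ℂ) ^ 2 *
            CavityQED.response p (CavityQED.vecPot p N d) (CavityQED.vecPot p N d) Ψ t t') ∧
      -- the propagator of the vector potential in frequency
      (∀ w η : ℝ, 0 < η →
        CavityQED.responseFreq p (CavityQED.vecPot p N d) (CavityQED.vecPot p N d) Ψ
            ((w : ℂ) + Complex.I * η) =
          -1 / ((2 * p.eps0 * CavityQED.dressedFreq p N * CavityQED.volume p : ℝ) : ℂ) *
            (1 / ((w : ℂ) + CavityQED.dressedFreq p N + Complex.I * η)
              - 1 / ((w : ℂ) - CavityQED.dressedFreq p N + Complex.I * η))) ∧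
      -- the Kubo conductivity is the ratio of induced current density and applied electric field
      (∀ (w η : ℝ) (A : ℝ → ℝ), 0 < η → ContDiff ℝ 1 A → (∀ t ≤ 0, A t = 0) →
        MeasureTheory.Integrable (fun t : ℝ => Real.exp (-(η * t)) * A t) →
        MeasureTheory.Integrable (fun t : ℝ => Real.exp (-(η * t)) * deriv A t) →
        MeasureTheory.Integrable (fun t : ℝ =>
          Complex.exp (Complex.I * ((w : ℂ) + Complex.I * η) * t) *
            CavityQED.inducedCurrent p d Ψ A t) ∧
        ∫ t : ℝ, Complex.exp (Complex.I * ((w : ℂ) + Complex.I * η) * t) *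
            CavityQED.inducedCurrent p d Ψ A t =
          CavityQED.conductivity p d Ψ ((w : ℂ) + Complex.I * η) *
            ∫ t : ℝ, Complex.exp (Complex.I * ((w : ℂ) + Complex.I * η) * t) *
              ((-(deriv A t) : ℝ) : ℂ)) ∧
      -- Drude term plus cavity term proportional to the propagator of the vector potential
      (∀ w η : ℝ, 0 < η →
        CavityQED.conductivity p d Ψ ((w : ℂ) + Complex.I * η) =
          CavityQED.drudeTerm p N ((w : ℂ) + Complex.I * η) +
          Complex.I * ((p.charge ^ 2 * N / p.mass : ℝ) : ℂ) ^ 2 /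
            ((CavityQED.volume p : ℂ) * ((w : ℂ) + Complex.I * η)) *
            CavityQED.responseFreq p (CavityQED.vecPot p N d) (CavityQED.vecPot p N d) Ψ
              ((w : ℂ) + Complex.I * η)) ∧
      -- the explicit optical conductivity
      (∀ w η : ℝ, 0 < η →
        CavityQED.conductivity p d Ψ ((w : ℂ) + Complex.I * η) =
          Complex.I * p.eps0 * (CavityQED.plasmaFreq p N : ℂ) ^ 2 / ((w : ℂ) + Complex.I * η) -
          Complex.I * p.eps0 * (CavityQED.plasmaFreq p N : ℂ) ^ 4 /
            (((w : ℂ) + Complex.I * η) * (2 * CavityQED.dressedFreq p N)) *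
            (1 / ((w : ℂ) + CavityQED.dressedFreq p N + Complex.I * η)
              - 1 / ((w : ℂ) - CavityQED.dressedFreq p N + Complex.I * η))) ∧
      -- its limit for vanishing `η`
      (∀ w : ℝ, w ≠ 0 → w ≠ CavityQED.dressedFreq p N → w ≠ -CavityQED.dressedFreq p N →
        Filter.Tendsto
          (fun η : ℝ => CavityQED.conductivity p d Ψ ((w : ℂ) + Complex.I * η))
          (nhdsWithin 0 (Set.Ioi 0))
          (nhds (Complex.I * p.eps0 * (CavityQED.plasmaFreq p N : ℂ) ^ 2 / (w : ℂ) -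
            Complex.I * p.eps0 * (CavityQED.plasmaFreq p N : ℂ) ^ 4 /
              ((w : ℂ) * (2 * CavityQED.dressedFreq p N)) *
              (1 / ((w : ℂ) + CavityQED.dressedFreq p N)
                - 1 / ((w : ℂ) - CavityQED.dressedFreq p N))))) ∧
      -- poles: simple ones at `±ω̃` for the propagator, at `0` and `±ω̃` for the conductivity
      (∃ S X : ℂ → ℂ,
        (∀ z : ℂ, 0 < z.im → S z = CavityQED.conductivity p d Ψ z) ∧
        (∀ z : ℂ, 0 < z.im →
          X z = CavityQED.responseFreq p (CavityQED.vecPot p N d) (CavityQED.vecPot p N d) Ψ z) ∧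
        (∀ z : ℂ, z ≠ 0 → z ≠ CavityQED.dressedFreq p N → z ≠ -CavityQED.dressedFreq p N →
          AnalyticAt ℂ S z) ∧
        (∀ z : ℂ, z ≠ CavityQED.dressedFreq p N → z ≠ -CavityQED.dressedFreq p N →
          AnalyticAt ℂ X z) ∧
        (∀ z : ℂ, z = 0 ∨ z = CavityQED.dressedFreq p N ∨ z = -CavityQED.dressedFreq p N →
          MeromorphicAt S z ∧ meromorphicOrderAt S z = -1) ∧
        (∀ z : ℂ, z = CavityQED.dressedFreq p N ∨ z = -CavityQED.dressedFreq p N →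
          MeromorphicAt X z ∧ meromorphicOrderAt X z = -1)) ∧
      -- the Drude peak: `σ0` without and `σdc` with the cavity contribution
      (∃ σ0 σdc : ℝ → ℝ,
        (∀ η : ℝ, 0 < η →
          Filter.Tendsto
            (fun w : ℝ => (CavityQED.drudeTerm p N ((w : ℂ) + Complex.I * η)).re)
            (nhds 0) (nhds (σ0 η)) ∧
          Filter.Tendsto
            (fun w : ℝ => (CavityQED.conductivity p d Ψ ((w : ℂ) + Complex.I * η)).re)
            (nhds 0) (nhds (σdc η)) ∧
          σ0 η = p.eps0 * CavityQED.plasmaFreq p N ^ 2 / η ∧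
          σdc η = σ0 η *
            (1 - CavityQED.coupling p N / (1 + η ^ 2 / CavityQED.dressedFreq p N ^ 2))) ∧
        Filter.Tendsto (fun η : ℝ => σdc η / σ0 η) (nhdsWithin 0 (Set.Ioi 0))
          (nhds (1 - CavityQED.coupling p N)) ∧
        Filter.Tendsto (fun η : ℝ => σdc η - σ0 η * (1 - CavityQED.coupling p N))
          (nhdsWithin 0 (Set.Ioi 0)) (nhds 0)) := by
  refine ⟨CavityQED.exists_isGroundState p N,
    ⟨CavityQED.coupling_pos p hN, CavityQED.coupling_lt_one p N⟩, fun Ψ d hΨ => ?_⟩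
  -- Apart from the vanishing current of the Fermi sea, all claims use only that `Ψ` is a normalized
  -- dressed vacuum.
  obtain ⟨ε, hv⟩ : ∃ ε, CavityQED.IsDressedVacuum p ε (Ψ : CavityQED.Amp N) :=
    hΨ.elim (fun h => h.isDressedVacuum) fun h => h.isDressedVacuum
  have h1 : ‖Ψ‖ = 1 := hΨ.elim (fun h => h.2.1) fun h => h.1
  have him : ∀ w η : ℝ, 0 < η → 0 < ((w : ℂ) + Complex.I * η).im := fun w η hη => by simpa using hη
  have hIim : ∀ η : ℝ, 0 < η → 0 < (Complex.I * η).im := fun η hη => by simpa using hη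
  refine ⟨fun h => ⟨h.applyOp_currentPara d, h.inner_current d⟩,
    fun t t' => ⟨hv.response_vecPot h1 d t t', hv.response_current h1 d t t'⟩,
    fun w η hη => ?_, fun w η A hη hA hA0 hi hi' => ?_,
    fun w η _ => hv.conductivity_eq_drude_add h1 d _, fun w η hη => ?_,
    fun w h0 h2 h3 => ?_,
    ⟨CavityQED.opticalConductivity p N, CavityQED.propagator p N,
      fun z hz => (hv.conductivity_eq h1 d hz).symm,
      fun z hz => (hv.responseFreq_vecPot h1 d hz).symm,
      fun z => CavityQED.analyticAt_opticalConductivity,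
      fun z => CavityQED.analyticAt_propagator,
      fun z => CavityQED.opticalConductivity_order hN,
      fun z => CavityQED.propagator_order⟩,
    ⟨fun η => p.eps0 * CavityQED.plasmaFreq p N ^ 2 / η, CavityQED.dcConductivity p N,
      fun η hη => ⟨?_, ?_, rfl, rfl⟩, CavityQED.tendsto_dcConductivity_div p hN,
      CavityQED.tendsto_dcConductivity_sub p N⟩⟩
  · rw [hv.responseFreq_vecPot h1 d (him w η hη), CavityQED.propagator, add_right_comm (w : ℂ),
      sub_add_eq_add_sub]
  -- The modulus of `e^{izt}` is `e^{-ηt}`, so the real integrability hypotheses carry over.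
  · have key : ∀ B : ℝ → ℝ, Continuous B →
        MeasureTheory.Integrable (fun t : ℝ => Real.exp (-(η * t)) * B t) →
        MeasureTheory.Integrable fun t : ℝ =>
          Complex.exp (Complex.I * ((w : ℂ) + Complex.I * η) * t) * (B t : ℂ) := by
      intro B hB hBi
      refine hBi.mono (Continuous.aestronglyMeasurable (by fun_prop))
        (Filter.Eventually.of_forall fun t => le_of_eq ?_)
      rw [norm_mul, norm_mul, Complex.norm_exp, Complex.norm_real, Real.norm_of_nonneg
        (Real.exp_pos _).le]
      congr 2
      simp
    exact hv.laplace_inducedCurrent h1 d (him w η hη) hA hA0 (key A hA.continuous hi)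
      (key (deriv A) (hA.continuous_deriv le_rfl) hi')
  · rw [hv.conductivity_eq h1 d (him w η hη), CavityQED.opticalConductivity,
      add_right_comm (w : ℂ), sub_add_eq_add_sub]
  · refine (CavityQED.tendsto_opticalConductivity h0 h2 h3).congr' ?_
    filter_upwards [self_mem_nhdsWithin] with η hη
    exact (hv.conductivity_eq h1 d (him w η hη)).symm
  · refine CavityQED.tendsto_re_add_I_mul ?_ (CavityQED.drudeTerm_I_mul η)
    exact continuousAt_const.div continuousAt_id
      (by simpa using CavityQED.ne_ofReal_of_im_pos (hIim η hη) 0)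
  · simp only [hv.conductivity_eq h1 d (him _ η hη)]
    refine CavityQED.tendsto_re_add_I_mul
      (CavityQED.analyticAt_opticalConductivity ?_ ?_ ?_).continuousAt
      (CavityQED.opticalConductivity_I_mul hη)
    · simpa using CavityQED.ne_ofReal_of_im_pos (hIim η hη) 0
    · exact CavityQED.ne_ofReal_of_im_pos (hIim η hη) _
    · simpa using CavityQED.ne_ofReal_of_im_pos (hIim η hη) (-CavityQED.dressedFreq p N)
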